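/- Let $X$ be a proper geodesic Gromov hyperbolic metric space and let $\Gamma$ be a countable group acting on $X$ by isometries. Assume that the action is non-elementary, i.e. $\Gamma$ contains two elements acting loxodromically (with positive stable translation length) that have no common fixed point on the Gromov boundary $\partial X$. Let $\mu$ be a probability measure on $\Gamma$ whose support generates $\Gamma$ as a semigroup, let $o\in X$, and assume that $\mu$ has a finite exponential moment: $\sum_{g\in\Gamma} e^{t\,d(o,go)}\mu(g)<\infty$ for some $t>0$. Let $g_1,g_2,\dots$ be independent random variables with law $\mu$, and let $\omega_n=g_1g_2\cdots g_n$ (with $\omega_0=e$) be the random walk; let $P$ denote the corresponding probability measure. Then almost surely $\omega_n o$ converges to a unique point $\omega_\infty\in\partial X$, which is the endpoint of some geodesic ray from $o$, and there exists $C>0$ such that for all integers $0\le k\le n$ and all real $a>1$ $$P\big(d(\omega_k o,[o,\omega_n o])>a\big)\le C e^{-a/C} \qquad\text{and}\qquad P\big(d(\omega_k o,[o,\omega_\infty))>a\big)\le C e^{-a/C},$$ where $[o,\omega_n o]$ and $[o,\omega_\infty)$ are any geodesics connecting the respective endpoints. (Precisely, the bounds hold for the (outer) probability of the event that some geodesic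 from $o$ to $\omega_n o$, respectively some geodesic ray from $o$ to $\omega_\infty$, is at distance more than $a$ from $\omega_k o$.) -/

import Mathlib

open MeasureTheory Filter
open scoped NNReal ENNReal

noncomputable section

/-- The Gromov product of `x` and `y` based at `p`. -/
def gromovProduct {X : Type*} [MetricSpace X] (p x y : X) : ℝ :=
  (dist p x + dist p y - dist x y) / 2

/-- Gromov hyperbolicity: the four-point condition holds for some constant. -/
def IsGromovHyperbolic (X : Type*) [MetricSpace X] : Prop :=
  ∃ δ : ℝ, ∀ p x y z : X,
    min (gromovProduct p x y) (gromovProduct p y z) - δ ≤ gromovProduct p x z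

/-- `γ`, restricted to `[0, dist x y]`, is a geodesic from `x` to `y` parametrized by arc length. -/
def IsGeodesicBetween {X : Type*} [MetricSpace X] (γ : ℝ → X) (x y : X) : Prop :=
  γ 0 = x ∧ γ (dist x y) = y ∧
    ∀ s ∈ Set.Icc 0 (dist x y), ∀ t ∈ Set.Icc 0 (dist x y), dist (γ s) (γ t) = |s - t|

/-- Any two points are joined by a geodesic. -/
def IsGeodesicSpace (X : Type*) [MetricSpace X] : Prop :=
  ∀ x y : X, ∃ γ : ℝ → X, IsGeodesicBetween γ x y

/-- Geodesic rays: isometric embeddings of `[0, ∞)`. -/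
def GeodesicRay (X : Type*) [MetricSpace X] : Type _ :=
  {γ : ℝ≥0 → X // Isometry γ}

/-- Two geodesic rays are asymptotic if they stay at bounded distance from each other. -/
def asymptoticSetoid (X : Type*) [MetricSpace X] : Setoid (GeodesicRay X) where
  r γ γ' := ∃ K : ℝ, ∀ t : ℝ≥0, dist (γ.1 t) (γ'.1 t) ≤ K
  iseqv :=
    { refl := fun γ => ⟨0, fun t => by simp⟩
      symm := fun {γ γ'} ⟨K, hK⟩ => ⟨K, fun t => by rw [dist_comm]; exact hK t⟩
      trans := fun {γ γ' γ''} ⟨K, hK⟩ ⟨L, hL⟩ =>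
        ⟨K + L, fun t => (dist_triangle _ (γ'.1 t) _).trans (add_le_add (hK t) (hL t))⟩ }

/-- The Gromov boundary of a proper geodesic hyperbolic space: asymptoty classes of rays. -/
def GromovBoundary (X : Type*) [MetricSpace X] : Type _ :=
  Quotient (asymptoticSetoid X)

/-- The endpoint at infinity of a geodesic ray. -/
def GeodesicRay.endpoint {X : Type*} [MetricSpace X] (γ : GeodesicRay X) : GromovBoundary X :=
  Quotient.mk (asymptoticSetoid X) γ

/-- The sequence `x` of points of `X` converges to the boundary point `ξ`: for a ray `γ` ending at
`ξ`, the Gromov products of `x n` and `γ t` tend to infinity as `n` and `t` do. The choice of the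
ray and of the base point of the Gromov product do not matter, since they change the Gromov
products by a bounded amount. -/
def ConvergesToBoundary {X : Type*} [MetricSpace X] (x : ℕ → X) (ξ : GromovBoundary X) : Prop :=
  ∃ γ : GeodesicRay X, γ.endpoint = ξ ∧
    Tendsto (fun p : ℕ × ℝ≥0 => gromovProduct (γ.1 0) (x p.1) (γ.1 p.2))
      (atTop ×ˢ atTop) atTop

section Action

variable {Γ X : Type*} [Group Γ] [MetricSpace X] [MulAction Γ X] [IsIsometricSMul Γ X]

/-- The image of a geodesic ray under an isometry. -/
def GeodesicRay.translate (g : Γ) (γ : GeodesicRay X) : GeodesicRay X :=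
  ⟨fun t => g • γ.1 t, (isometry_smul X g).comp γ.2⟩

/-- The action of an isometry on the Gromov boundary. -/
def boundaryMap (g : Γ) : GromovBoundary X → GromovBoundary X :=
  Quotient.map' (s₁ := asymptoticSetoid X) (s₂ := asymptoticSetoid X) (GeodesicRay.translate g)
    (fun _ _ ⟨K, hK⟩ => ⟨K, fun t => by
      simpa only [GeodesicRay.translate, dist_smul] using hK t⟩)

end Action

/-- `g` acts as a loxodromic isometry: its stable translation length
`inf_n dist x (g ^ n • x) / n`, which does not depend on `x`, is positive. -/
def IsLoxodromic {Γ : Type*} (X : Type*) [Group Γ] [MetricSpace X] [MulAction Γ X] (g : Γ) : Prop :=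
  ∃ c : ℝ, 0 < c ∧ ∀ (x : X) (n : ℕ), c * n ≤ dist x (g ^ n • x)

/-- Non-elementary action: there are two loxodromic elements without a common fixed point at
infinity. -/
def IsNonElementary (Γ X : Type*) [Group Γ] [MetricSpace X] [MulAction Γ X]
    [IsIsometricSMul Γ X] : Prop :=
  ∃ g h : Γ, IsLoxodromic X g ∧ IsLoxodromic X h ∧
    ∀ ξ : GromovBoundary X, ¬ (boundaryMap g ξ = ξ ∧ boundaryMap h ξ = ξ)

/-- The support of `μ` generates `Γ` as a semigroup. -/
def GeneratesAsSemigroup {Γ : Type*} [Group Γ] [MeasurableSpace Γ] (μ : Measure Γ) : Prop :=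
  Subsemigroup.closure {g : Γ | μ {g} ≠ 0} = ⊤

/-- Finite exponential moment with respect to the displacement of the base point `o`. -/
def HasExponentialMoment {Γ X : Type*} [Group Γ] [MeasurableSpace Γ] [MetricSpace X]
    [MulAction Γ X] (μ : Measure Γ) (o : X) : Prop :=
  ∃ t : ℝ, 0 < t ∧ ∫⁻ g, ENNReal.ofReal (Real.exp (t * dist o (g • o))) ∂μ < ∞

/-- The position at time `n` of the random walk with increments `s 0, s 1, …`, started at `1`:
`walk s n = s 0 * s 1 * ⋯ * s (n - 1)`. -/
def walk {Γ : Type*} [Group Γ] (s : ℕ → Γ) : ℕ → Γ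
  | 0 => 1
  | n + 1 => walk s n * s n

/-- The law of the sequence of increments of the random walk: they are independent with law `μ`. -/
def walkMeasure {Γ : Type*} [MeasurableSpace Γ] (μ : Measure Γ) [IsProbabilityMeasure μ] :
    Measure (ℕ → Γ) :=
  Measure.infinitePi (fun _ : ℕ => μ)

end

set_option linter.unusedSectionVars false

/-! For k ≤ n, the distance from ω_k o to [o, ω_n o] is, up to 2δ, at most the Gromov product of o
and ω_n o based at ω_k o. Translating by ω_k⁻¹ turns this into the product based at o of z = ω_k⁻¹ o
and ω_k⁻¹ ω_n o. The second point is independent of the first, so it suffices to bound an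
exponential moment of the product of ω_m o with z, uniformly in m and z
(`FourPoint.exists_lintegral_product_le`).

That bound comes from a uniform drift. Ping-pong with two loxodromic elements gives five words,
charged by one common convolution power of μ, that increase distances on average
(`IsNonElementary.exists_expanding`). Induction on time then shows that the expected distance to
every z grows linearly, with a loss independent of z (`expectedDist_ge`). By the exponential moment,
the increments d(ω_N o, z) - d(o, z) have, for some N, a negative exponential moment below 1
uniformly in z (`exists_contraction`). Since a large Gromov product changes under a first block of
steps by this increment, up to δ, its exponential moment satisfies a contracting recursion.

The same contraction gives linear progress. With the deviation bound and Borel–Cantelli, Gromov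
products along almost every trajectory tend to infinity, so it converges to the end of a ray
(`ae_exists_product_ge`, `FourPoint.exists_ray_of_product`). The ray estimate is a limit of the
segment estimates. -/

/-- The four-point condition with a nonnegative constant `δ`. -/
def FourPoint (X : Type*) [MetricSpace X] (δ : ℝ) : Prop :=
  0 ≤ δ ∧ ∀ p x y z : X,
    min (gromovProduct p x y) (gromovProduct p y z) - δ ≤ gromovProduct p x z

theorem IsGromovHyperbolic.exists_fourPoint {X : Type*} [MetricSpace X]
    (h : IsGromovHyperbolic X) : ∃ δ, FourPoint X δ := by
  obtain ⟨δ, hδ⟩ := h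
  refine ⟨max δ 0, le_max_right _ _, fun p x y z => ?_⟩
  have := hδ p x y z
  have := le_max_left δ 0
  linarith

/-! ### Gromov products and the four-point condition -/

section Geometry

variable {X : Type*} [MetricSpace X]

theorem gromovProduct_comm (p x y : X) : gromovProduct p x y = gromovProduct p y x := by
  unfold gromovProduct; rw [dist_comm x y]; ring

theorem gromovProduct_nonneg (p x y : X) : 0 ≤ gromovProduct p x y := by
  unfold gromovProduct
  have := dist_triangle_left x y p
  linarith

theorem gromovProduct_le_left (p x y : X) : gromovProduct p x y ≤ dist p x := by
  unfold gromovProduct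
  have := dist_triangle p x y
  linarith

theorem gromovProduct_le_right (p x y : X) : gromovProduct p x y ≤ dist p y := by
  rw [gromovProduct_comm]; exact gromovProduct_le_left p y x

theorem gromovProduct_self (p x : X) : gromovProduct p x x = dist p x := by
  simp [gromovProduct]

theorem gromovProduct_add_gromovProduct (p x y : X) :
    gromovProduct p x y + gromovProduct x p y = dist p x := by
  unfold gromovProduct; rw [dist_comm x p]; ring

theorem gromovProduct_le_add_dist_left (p x x' y : X) :
    gromovProduct p x y ≤ gromovProduct p x' y + dist x x' := by
  unfold gromovProduct
  have h1 := dist_triangle p x' x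
  have h2 := dist_triangle x' x y
  rw [dist_comm x' x] at h1 h2
  linarith

theorem gromovProduct_le_add_dist_right (p x y y' : X) :
    gromovProduct p x y ≤ gromovProduct p x y' + dist y y' := by
  rw [gromovProduct_comm p x y, gromovProduct_comm p x y']
  exact gromovProduct_le_add_dist_left p y y' x

theorem gromovProduct_le_add_dist_base (p p' x y : X) :
    gromovProduct p x y ≤ gromovProduct p' x y + dist p p' := by
  unfold gromovProduct
  have h1 := dist_triangle p p' x
  have h2 := dist_triangle p p' y
  linarith

theorem gromovProduct_smul {Γ : Type*} [Group Γ] [MulAction Γ X] [IsIsometricSMul Γ X]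
    (g : Γ) (p x y : X) : gromovProduct (g • p) (g • x) (g • y) = gromovProduct p x y := by
  simp [gromovProduct]

theorem dist_smul_eq_dist_inv_smul {Γ : Type*} [Group Γ] [MulAction Γ X] [IsIsometricSMul Γ X]
    (g : Γ) (x y : X) : dist (g • x) y = dist x (g⁻¹ • y) := by
  rw [← dist_smul g x (g⁻¹ • y), smul_inv_smul]

namespace FourPoint

variable {δ : ℝ} (hX : FourPoint X δ)
include hX

theorem nonneg : 0 ≤ δ := hX.1

theorem min_le (p x y z : X) :
    min (gromovProduct p x y) (gromovProduct p y z) - δ ≤ gromovProduct p x z := hX.2 p x y z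

theorem le_product {p x y z : X} {r : ℝ} (h : r ≤ gromovProduct p x y)
    (h' : r ≤ gromovProduct p y z) : r - δ ≤ gromovProduct p x z :=
  (sub_le_sub_right (le_min h h') δ).trans (hX.min_le p x y z)

/-- The two smallest of the three products agree up to δ. This is the ping-pong form: `y` points
towards `z`, `x` does not, hence `x` does not point towards `y`. -/
theorem product_le {p x y z : X} {r : ℝ} (h : gromovProduct p x z ≤ r)
    (h' : r + δ < gromovProduct p y z) : gromovProduct p x y ≤ r + δ := by
  by_contra! hc
  have := hX.min_le p x y z
  have := lt_min hc h'
  linarith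

/-- A point is at distance from a geodesic segment at most the Gromov product of the endpoints,
up to `2 δ`. -/
theorem exists_dist_le {γ : ℝ → X} {x y : X} (hγ : IsGeodesicBetween γ x y) (p : X) :
    ∃ t ∈ Set.Icc 0 (dist x y), dist p (γ t) ≤ gromovProduct p x y + 2 * δ := by
  obtain ⟨h0, h1, h2⟩ := hγ
  -- The witness is the foot of `p` in the comparison tripod. The Gromov product of `x` and `y`
  -- based there vanishes, so the four-point condition makes one of its products with `p` at most
  -- `δ`.
  have hx : gromovProduct x p y ∈ Set.Icc 0 (dist x y) :=
    ⟨gromovProduct_nonneg _ _ _, gromovProduct_le_right _ _ _⟩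
  refine ⟨_, hx, ?_⟩
  set t := gromovProduct x p y with ht
  have hxw : dist x (γ t) = t := by
    conv_lhs => rw [← h0]
    rw [h2 0 ⟨le_rfl, dist_nonneg⟩ t hx, zero_sub, abs_neg, abs_of_nonneg hx.1]
  have hwy : dist (γ t) y = dist x y - t := by
    conv_lhs => rw [← h1]
    rw [h2 t hx _ ⟨dist_nonneg, le_rfl⟩, abs_sub_comm, abs_of_nonneg (by linarith [hx.2])]
  have hz := hX.min_le (γ t) x p y
  have hz0 : gromovProduct (γ t) x y = 0 := by
    unfold gromovProduct; rw [dist_comm (γ t) x, hxw, hwy]; ring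
  rw [hz0] at hz
  have hxp := gromovProduct_add_gromovProduct x p y
  have : gromovProduct x p y + gromovProduct p x y = dist x p := by
    rw [← gromovProduct_add_gromovProduct x p y]
  rcases min_le_iff.1 (sub_nonpos.1 hz) with h | h
  · unfold gromovProduct at h this ht ⊢
    rw [dist_comm (γ t) x, hxw, dist_comm (γ t) p] at h
    have := dist_comm x p
    linarith
  · unfold gromovProduct at h this ht ⊢
    rw [hwy, dist_comm (γ t) p] at h
    have := dist_comm x p
    linarith

theorem infDist_le {γ : ℝ → X} {x y : X} (hγ : IsGeodesicBetween γ x y) (p : X) :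
    Metric.infDist p (γ '' Set.Icc 0 (dist x y)) ≤ gromovProduct p x y + 2 * δ := by
  obtain ⟨t, ht, h⟩ := hX.exists_dist_le hγ p
  exact (Metric.infDist_le_dist_of_mem (Set.mem_image_of_mem γ ht)).trans h

/-- If a Gromov product exceeds the displacement, it is changed by a translation by at least the
value of the Busemann cocycle. -/
theorem product_le_max (o p x z : X) :
    gromovProduct o x z ≤ max (dist o p + δ)
      (gromovProduct p x z - (dist p z - dist o z) + δ) := by
  rcases le_or_gt (gromovProduct o x z) (dist o p + δ) with h | h
  · exact le_max_of_le_left h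
  refine le_max_of_le_right ?_
  have h1 := gromovProduct_le_left o p z
  have h2 : gromovProduct o p x ≤ gromovProduct o p z + δ :=
    hX.product_le le_rfl (by linarith)
  unfold gromovProduct at *
  linarith

end FourPoint

end Geometry

/-! ### Convergence to the Gromov boundary -/

section Boundary

variable {X : Type*} [MetricSpace X] {δ : ℝ}

theorem GeodesicRay.dist_zero (γ : GeodesicRay X) (t : ℝ≥0) : dist (γ.1 0) (γ.1 t) = t := by
  rw [γ.2.dist_eq, NNReal.dist_eq]; simp

theorem GeodesicRay.product_eq (γ : GeodesicRay X) {s t : ℝ≥0} (h : s ≤ t) :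
    gromovProduct (γ.1 0) (γ.1 s) (γ.1 t) = s := by
  have : (s : ℝ) ≤ t := h
  unfold gromovProduct
  rw [γ.dist_zero, γ.dist_zero, γ.2.dist_eq, NNReal.dist_eq, abs_sub_comm,
    abs_of_nonneg (by linarith)]
  ring

theorem GeodesicRay.isGeodesicBetween (γ : GeodesicRay X) (t : ℝ≥0) :
    IsGeodesicBetween (fun r => γ.1 r.toNNReal) (γ.1 0) (γ.1 t) := by
  refine ⟨by simp, by rw [γ.dist_zero]; simp, fun a ha b hb => ?_⟩
  rw [γ.2.dist_eq, NNReal.dist_eq, Real.coe_toNNReal _ ha.1, Real.coe_toNNReal _ hb.1]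

/-- Convergence to the endpoint of `γ` in terms of `γ` itself and of an arbitrary base point. -/
theorem ConvergesToBoundary.exists_product {x : ℕ → X} {γ : GeodesicRay X}
    (h : ConvergesToBoundary x γ.endpoint) (p : X) (R : ℝ) :
    ∃ (N : ℕ) (T : ℝ≥0), ∀ n ≥ N, ∀ t ≥ T, R ≤ gromovProduct p (x n) (γ.1 t) := by
  obtain ⟨γ', hγ', h⟩ := h
  obtain ⟨K, hK⟩ := Quotient.exact hγ'
  have := h.eventually_ge_atTop (R + K + dist (γ'.1 0) p)
  rw [prod_atTop_atTop_eq, eventually_atTop] at this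
  obtain ⟨⟨N, T⟩, hNT⟩ := this
  refine ⟨N, T, fun n hn t ht => ?_⟩
  have h1 := hNT (n, t) ⟨hn, ht⟩
  have h2 := gromovProduct_le_add_dist_base (γ'.1 0) p (x n) (γ'.1 t)
  have h3 := gromovProduct_le_add_dist_right p (x n) (γ'.1 t) (γ.1 t)
  have h4 := hK t
  simp only at h1
  linarith

theorem convergesToBoundary_of_exists_product {x : ℕ → X} {γ : GeodesicRay X}
    (h : ∀ R : ℝ, ∃ (N : ℕ) (T : ℝ≥0), ∀ n ≥ N, ∀ t ≥ T,
      R ≤ gromovProduct (γ.1 0) (x n) (γ.1 t)) :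
    ConvergesToBoundary x γ.endpoint := by
  refine ⟨γ, rfl, tendsto_atTop.2 fun R => ?_⟩
  obtain ⟨N, T, hNT⟩ := h R
  rw [prod_atTop_atTop_eq, eventually_atTop]
  exact ⟨(N, T), fun p hp => hNT _ hp.1 _ hp.2⟩

/-- Join γ(s) to γ'(s) through far points of both rays. Two uses of the four-point condition make
their Gromov product at least s up to a constant, which bounds their distance. -/
theorem FourPoint.endpoint_eq_of_product (hX : FourPoint X δ) {γ γ' : GeodesicRay X} {p : X}
    (h : ∀ R : ℝ, ∃ T : ℝ≥0, ∀ t ≥ T, R ≤ gromovProduct p (γ.1 t) (γ'.1 t)) :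
    γ.endpoint = γ'.endpoint := by
  refine Quotient.sound ⟨2 * (2 * (dist p (γ.1 0) + dist p (γ'.1 0)) + 2 * δ), fun s => ?_⟩
  have hδ := hX.nonneg
  set D := dist p (γ.1 0) + dist p (γ'.1 0) with hD
  obtain ⟨T, hT⟩ := h s
  have h1 := hT (max s T) (le_max_right _ _)
  have h2 := γ.product_eq (le_max_left s T)
  have h3 := γ'.product_eq (le_max_left s T)
  have h4 := gromovProduct_le_add_dist_base (γ.1 0) p (γ.1 s) (γ.1 (max s T))
  have h5 := gromovProduct_le_add_dist_base (γ'.1 0) p (γ'.1 s) (γ'.1 (max s T))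
  rw [dist_comm _ p] at h4 h5
  have e1 : 0 ≤ dist p (γ.1 0) := dist_nonneg
  have e2 : 0 ≤ dist p (γ'.1 0) := dist_nonneg
  have h6 := hX.le_product (p := p) (x := γ.1 s) (y := γ.1 (max s T)) (z := γ'.1 (max s T))
    (r := s - D) (by linarith) (by linarith)
  rw [gromovProduct_comm p (γ'.1 s)] at h5
  have h7 := hX.le_product (r := s - D - δ) (by linarith) (show _ ≤ gromovProduct p (γ'.1 (max s T)) (γ'.1 s) by linarith)
  have h8 := dist_triangle p (γ.1 0) (γ.1 s)
  have h9 := dist_triangle p (γ'.1 0) (γ'.1 s)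
  rw [GeodesicRay.dist_zero] at h8 h9
  unfold gromovProduct at h7
  linarith

theorem FourPoint.boundary_limit_unique (hX : FourPoint X δ) {x : ℕ → X} {ξ ξ' : GromovBoundary X}
    (h : ConvergesToBoundary x ξ) (h' : ConvergesToBoundary x ξ') : ξ = ξ' := by
  obtain ⟨γ, rfl⟩ := Quotient.exists_rep ξ
  obtain ⟨γ', rfl⟩ := Quotient.exists_rep ξ'
  refine hX.endpoint_eq_of_product (p := x 0) fun R => ?_
  obtain ⟨N, T, hN⟩ := ConvergesToBoundary.exists_product h (x 0) (R + δ)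
  obtain ⟨N', T', hN'⟩ := ConvergesToBoundary.exists_product h' (x 0) (R + δ)
  refine ⟨max T T', fun t ht => ?_⟩
  have h1 := hN (max N N') (le_max_left _ _) t ((le_max_left _ _).trans ht)
  have h2 := hN' (max N N') (le_max_right _ _) t ((le_max_right _ _).trans ht)
  rw [gromovProduct_comm] at h1
  have := hX.le_product h1 h2
  linarith

theorem ConvergesToBoundary.of_dist_le {x y : ℕ → X} {ξ : GromovBoundary X}
    (h : ConvergesToBoundary x ξ) {K : ℝ} (hK : ∀ n, dist (x n) (y n) ≤ K) :
    ConvergesToBoundary y ξ := by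
  obtain ⟨γ, rfl⟩ := Quotient.exists_rep ξ
  refine convergesToBoundary_of_exists_product fun R => ?_
  obtain ⟨N, T, hN⟩ := ConvergesToBoundary.exists_product h (γ.1 0) (R + K)
  refine ⟨N, T, fun n hn t ht => ?_⟩
  have h1 := hN n hn t ht
  have h2 := gromovProduct_le_add_dist_left (γ.1 0) (x n) (y n) (γ.1 t)
  linarith [hK n]

theorem ConvergesToBoundary.smul {Γ : Type*} [Group Γ] [MulAction Γ X] [IsIsometricSMul Γ X]
    {x : ℕ → X} {ξ : GromovBoundary X} (h : ConvergesToBoundary x ξ) (g : Γ) :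
    ConvergesToBoundary (fun n => g • x n) (boundaryMap g ξ) := by
  obtain ⟨γ, rfl⟩ := Quotient.exists_rep ξ
  refine convergesToBoundary_of_exists_product (γ := GeodesicRay.translate g γ) fun R => ?_
  obtain ⟨N, T, hN⟩ := ConvergesToBoundary.exists_product h (γ.1 0) R
  refine ⟨N, T, fun n hn t ht => ?_⟩
  exact (hN n hn t ht).trans_eq (gromovProduct_smul g _ _ _).symm

/-- An isometry moving a converging sequence by a bounded amount fixes the limit. -/
theorem FourPoint.boundaryMap_eq (hX : FourPoint X δ) {Γ : Type*} [Group Γ] [MulAction Γ X]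
    [IsIsometricSMul Γ X] {x : ℕ → X} {ξ : GromovBoundary X} (h : ConvergesToBoundary x ξ) {g : Γ}
    {K : ℝ} (hK : ∀ n, dist (x n) (g • x n) ≤ K) : boundaryMap g ξ = ξ :=
  hX.boundary_limit_unique (h.smul g) (h.of_dist_le hK)

/-- In a proper space, a sequence whose mutual Gromov products tend to infinity converges to the
endpoint of a ray. -/
theorem FourPoint.exists_ray_of_product (hX : FourPoint X δ) [ProperSpace X]
    (hgeod : IsGeodesicSpace X) (o : X) {x : ℕ → X}
    (h : ∀ R : ℝ, ∃ N : ℕ, ∀ n ≥ N, ∀ m ≥ N, R ≤ gromovProduct o (x n) (x m)) :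
    ∃ γ : GeodesicRay X, γ.1 0 = o ∧ ConvergesToBoundary x γ.endpoint := by
  choose c hc using fun n => hgeod o (x n)
  have hdist : ∀ R : ℝ, ∀ᶠ n in (hyperfilter ℕ : Filter ℕ), R ≤ dist o (x n) := fun R => by
    obtain ⟨N, hN⟩ := h R
    filter_upwards [Nat.hyperfilter_le_atTop (eventually_ge_atTop N)] with n hn
    simpa [gromovProduct_self] using hN n hn n hn
  -- Limits along one fixed ultrafilter, at all times simultaneously, replace the extraction of a
  -- subsequence of geodesics; properness gives their existence.
  have hlim : ∀ t : ℝ≥0, ∃ y, Tendsto (fun n => c n t) (hyperfilter ℕ : Filter ℕ) (nhds y) := by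
    intro t
    have hK : IsCompact (Metric.closedBall o (t : ℝ)) := isCompact_closedBall _ _
    obtain ⟨y, -, hy⟩ := hK.ultrafilter_le_nhds ((hyperfilter ℕ).map fun n => c n t) (by
      rw [Ultrafilter.coe_map, le_principal_iff, mem_map]
      filter_upwards [hdist t] with n hn
      show c n t ∈ Metric.closedBall o (t : ℝ)
      rw [Metric.mem_closedBall, dist_comm]
      conv_lhs => rw [← (hc n).1]
      rw [(hc n).2.2 0 ⟨le_rfl, dist_nonneg⟩ t ⟨t.2, hn⟩]
      simp)
    exact ⟨y, hy⟩
  choose γ hγ using hlim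
  have hiso : Isometry γ := Isometry.of_dist_eq fun s t => by
    have h1 := (hγ s).dist (hγ t)
    refine tendsto_nhds_unique_of_eventuallyEq h1 (tendsto_const_nhds (x := dist s t)) ?_
    filter_upwards [hdist s, hdist t] with n hs ht
    rw [(hc n).2.2 s ⟨s.2, hs⟩ t ⟨t.2, ht⟩, NNReal.dist_eq]
  have h0 : γ 0 = o := tendsto_nhds_unique (hγ 0) (by
    simp only [NNReal.coe_zero, (hc _).1]; exact tendsto_const_nhds)
  refine ⟨⟨γ, hiso⟩, h0, convergesToBoundary_of_exists_product fun R => ?_⟩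
  obtain ⟨N, hN⟩ := h (R + δ)
  refine ⟨N, (R + δ + 1).toNNReal, fun n hn t ht => ?_⟩
  have ht' : R + δ + 1 ≤ t := (Real.le_coe_toNNReal _).trans (by exact_mod_cast ht)
  have hge : ∀ᶠ m in (hyperfilter ℕ : Filter ℕ), N ≤ m :=
    Nat.hyperfilter_le_atTop (eventually_ge_atTop N)
  obtain ⟨m, hm1, hm2, hm3⟩ := ((hdist t).and (hge.and
      ((hγ t).eventually (Metric.ball_mem_nhds _ one_pos)))).exists
  have h1 := hN n hn m hm2
  have h2 : gromovProduct o (x m) (c m t) = t := by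
    have e1 : dist o (c m t) = t := by
      conv_lhs => rw [← (hc m).1]
      rw [(hc m).2.2 0 ⟨le_rfl, dist_nonneg⟩ t ⟨t.2, hm1⟩]; simp
    have e2 : dist (x m) (c m t) = dist o (x m) - t := by
      conv_lhs => rw [← (hc m).2.1]
      rw [(hc m).2.2 _ ⟨dist_nonneg, le_rfl⟩ t ⟨t.2, hm1⟩, abs_of_nonneg (by linarith)]
    unfold gromovProduct; rw [e1, e2]; ring
  have h3 := gromovProduct_le_add_dist_right o (x m) (c m t) (γ t)
  have h4 : dist (c m t) (γ t) < 1 := hm3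
  have h5 := hX.le_product h1 (show R + δ ≤ gromovProduct o (x m) (γ t) by linarith)
  show R ≤ gromovProduct (γ 0) (x n) (γ t)
  rw [h0]; linarith

/-- The distance from a point to a ray is controlled by Gromov products along any sequence
converging to the endpoint of the ray. -/
theorem FourPoint.eventually_infDist_le (hX : FourPoint X δ) {x : ℕ → X} {γ : GeodesicRay X}
    (h : ConvergesToBoundary x γ.endpoint) (y : X) :
    ∃ N, ∀ n ≥ N, Metric.infDist y (Set.range γ.1) ≤ gromovProduct y (γ.1 0) (x n) + 3 * δ := by
  -- The threshold is the largest value a product of `γ.1 0` based at `y` can take, so the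
  -- four-point condition compares the products of `γ.1 0` with `γ.1 T` and with `x n` at the cost
  -- of one `δ`.
  obtain ⟨N, T, hN⟩ := h.exists_product y (dist y (γ.1 0))
  refine ⟨N, fun n hn => ?_⟩
  have h1 := hN n hn T le_rfl
  rw [gromovProduct_comm] at h1
  obtain ⟨t, -, ht⟩ := hX.exists_dist_le (γ.isGeodesicBetween T) y
  have h2 := hX.le_product le_rfl ((gromovProduct_le_left y (γ.1 0) (γ.1 T)).trans h1)
  have h3 : Metric.infDist y (Set.range γ.1) ≤ dist y (γ.1 t.toNNReal) :=
    Metric.infDist_le_dist_of_mem ⟨_, rfl⟩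
  linarith

end Boundary

/-! ### Loxodromic elements and their axes -/

section Loxodromic

variable {Γ X : Type*} [Group Γ] [MetricSpace X] [MulAction Γ X] [IsIsometricSMul Γ X] {δ : ℝ}

theorem dist_pow_smul_le (a : Γ) (o : X) (n : ℕ) :
    dist o (a ^ n • o) ≤ n * dist o (a • o) := by
  induction n with
  | zero => simp
  | succ n ih =>
    have h := dist_triangle o (a ^ n • o) (a ^ (n + 1) • o)
    rw [pow_succ, mul_smul, dist_smul] at h
    rw [pow_succ, mul_smul]
    push_cast
    linarith

theorem dist_inv_smul_self (a : Γ) (o : X) : dist o (a⁻¹ • o) = dist o (a • o) := by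
  rw [← dist_smul_eq_dist_inv_smul, dist_comm]

/-- The displacement of powers of a loxodromic element increases substantially under some
doubling of the exponent. -/
theorem IsLoxodromic.exists_pow {g : Γ} (hg : IsLoxodromic X g) (o : X) (K : ℝ) :
    ∃ n : ℕ, dist o (g ^ n • o) + K ≤ dist o ((g ^ n) ^ 2 • o) := by
  by_contra! h
  obtain ⟨c, hc, hg⟩ := hg
  -- Otherwise each doubling adds at most `K`, so the displacement of g^(2^k) is at most linear in
  -- k, against the lower bound c 2^k.
  have h1 : ∀ k : ℕ, dist o (g ^ (2 ^ k) • o) ≤ dist o (g • o) + k * K := by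
    intro k
    induction k with
    | zero => simp
    | succ k ih =>
      have := h (2 ^ k)
      rw [← pow_mul, ← pow_succ] at this
      push_cast
      linarith
  have h2 : Tendsto (fun k : ℕ => dist o (g • o) * (1 / 2 : ℝ) ^ k +
      (k ^ 1 / (2 : ℝ) ^ k) * K) atTop (nhds (dist o (g • o) * 0 + 0 * K)) :=
    ((tendsto_pow_atTop_nhds_zero_of_lt_one (by norm_num) (by norm_num)).const_mul _).add
      ((tendsto_pow_const_div_const_pow_of_one_lt 1 (by norm_num)).mul_const _)
  rw [mul_zero, zero_mul, add_zero] at h2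
  obtain ⟨k, hk⟩ := (h2.eventually_lt_const hc).exists
  have h3 := (hg o (2 ^ k)).trans (h1 k)
  have h4 : (0 : ℝ) < 2 ^ k := by positivity
  rw [one_div, inv_pow, pow_one, ← div_eq_mul_inv, div_mul_eq_mul_div, ← add_div,
    div_lt_iff₀ h4] at hk
  push_cast at h3
  linarith

/-- The orbit of `o` under the powers of `a` is a quasi-geodesic line, with constant `B`. -/
structure IsAxial (o : X) (a : Γ) (B : ℝ) : Prop where
  product_le : ∀ n m : ℕ, gromovProduct o (a⁻¹ ^ n • o) (a ^ m • o) ≤ B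
  le_dist : ∀ n : ℕ, (n : ℝ) ≤ dist o (a ^ n • o)

theorem IsAxial.inv {o : X} {a : Γ} {B : ℝ} (h : IsAxial o a B) : IsAxial o a⁻¹ B where
  product_le n m := by rw [inv_inv, gromovProduct_comm]; exact h.product_le m n
  le_dist n := by rw [inv_pow, dist_inv_smul_self]; exact h.le_dist n

/-- Seen from a^n o, the points o and a^m o lie in opposite directions along the axis, so their
product there is at most `B`; the complementary product based at o is then large. -/
theorem IsAxial.dist_sub_le_product {o : X} {a : Γ} {B : ℝ} (h : IsAxial o a B) {n m : ℕ}
    (hnm : n ≤ m) : dist o (a ^ n • o) - B ≤ gromovProduct o (a ^ n • o) (a ^ m • o) := by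
  have h1 := gromovProduct_add_gromovProduct o (a ^ n • o) (a ^ m • o)
  have h2 := h.product_le n (m - n)
  rw [← gromovProduct_smul (a ^ n), smul_smul, smul_smul, ← pow_add, inv_pow, mul_inv_cancel,
    one_smul, Nat.add_sub_cancel' hnm] at h2
  linarith

/-- The hypothesis says that a o and a⁻¹ o point in different directions. By induction a⁻¹ o and
a^(-n-1) o point in the same direction, which keeps a^(-n-1) o away from a o without accumulating
errors in δ. -/
theorem FourPoint.product_inv_pow_le (hX : FourPoint X δ) (o : X) (a : Γ)
    (ha : dist o (a • o) + (4 * δ + 2) ≤ dist o (a ^ 2 • o)) (n : ℕ) :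
    gromovProduct o (a⁻¹ ^ n • o) (a • o) ≤ (dist o (a • o) - (4 * δ + 2)) / 2 + δ := by
  have hδ := hX.nonneg
  have hL := dist_pow_smul_le a o 2
  push_cast at hL
  have h1 : gromovProduct o (a • o) (a⁻¹ • o) ≤ (dist o (a • o) - (4 * δ + 2)) / 2 := by
    unfold gromovProduct
    rw [dist_inv_smul_self, ← dist_smul a (a • o), smul_inv_smul, smul_smul, ← pow_two, dist_comm _ o]
    linarith
  induction n with
  | zero => simp [gromovProduct]; linarith
  | succ n ih =>
    rw [gromovProduct_comm]
    refine hX.product_le h1 ?_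
    have h2 := gromovProduct_add_gromovProduct o (a⁻¹ • o) (a⁻¹ ^ (n + 1) • o)
    rw [dist_inv_smul_self] at h2
    rw [← gromovProduct_smul a⁻¹, smul_smul, ← pow_succ', inv_smul_smul, gromovProduct_comm] at ih
    rw [gromovProduct_comm]
    linarith

/-- The margin `4 * δ + 2` lets the direction comparison be made once for each of `a` and `a⁻¹`, and
makes every further power gain at least 2δ + 2 in displacement. -/
theorem FourPoint.isAxial (hX : FourPoint X δ) (o : X) (a : Γ)
    (ha : dist o (a • o) + (4 * δ + 2) ≤ dist o (a ^ 2 • o)) :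
    IsAxial o a ((dist o (a • o) - (4 * δ + 2)) / 2 + 2 * δ) := by
  have hδ := hX.nonneg
  have h1 := hX.product_inv_pow_le o a ha
  have h2 := hX.product_inv_pow_le o a⁻¹
    (by rwa [inv_pow, dist_inv_smul_self, dist_inv_smul_self])
  rw [inv_inv, dist_inv_smul_self] at h2
  have hL := dist_pow_smul_le a o 2
  push_cast at hL
  refine ⟨fun n m => ?_, fun n => ?_⟩
  · cases m with
    | zero => simp [gromovProduct, dist_comm]; linarith
    | succ m =>
      have h3 := hX.product_le (h1 n) (y := a ^ (m + 1) • o) (by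
        have h4 := h2 m
        have h5 := gromovProduct_add_gromovProduct o (a • o) (a ^ (m + 1) • o)
        rw [← gromovProduct_smul a, smul_smul, ← pow_succ', smul_inv_smul,
          gromovProduct_comm] at h4
        rw [gromovProduct_comm]
        linarith)
      linarith
  · induction n with
    | zero => simp
    | succ n ih =>
      have h3 := h1 n
      unfold gromovProduct at h3
      rw [inv_pow, dist_inv_smul_self, ← dist_smul (a ^ n) ((a ^ n)⁻¹ • o), smul_inv_smul, smul_smul,
        ← pow_succ] at h3
      push_cast
      linarith

theorem IsAxial.nonneg {o : X} {a : Γ} {B : ℝ} (h : IsAxial o a B) : 0 ≤ B :=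
  (gromovProduct_nonneg _ _ _).trans (h.product_le 0 0)

/-- If two axial elements have forward orbits with unbounded Gromov products, then isometries
commuting with them share a fixed point at infinity. -/
theorem FourPoint.exists_common_fixed_point (hX : FourPoint X δ) [ProperSpace X]
    (hgeod : IsGeodesicSpace X) {o : X} {a b g h : Γ} {B B' : ℝ} (ha : IsAxial o a B)
    (hb : IsAxial o b B') (hag : Commute a g) (hbh : Commute b h)
    (hab : ∀ A : ℝ, ∃ p q : ℕ, A < gromovProduct o (a ^ p • o) (b ^ q • o)) :
    ∃ ξ : GromovBoundary X, boundaryMap g ξ = ξ ∧ boundaryMap h ξ = ξ := by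
  have hδ := hX.nonneg
  have hB := ha.nonneg
  have hB' := hb.nonneg
  -- A large product at one pair of exponents persists at all larger ones, because each orbit keeps
  -- going in the direction it has taken.
  have key : ∀ R : ℝ, ∃ p q : ℕ, ∀ n ≥ p, ∀ m ≥ q,
      R ≤ gromovProduct o (a ^ n • o) (b ^ m • o) := fun R => by
    obtain ⟨p, q, hpq⟩ := hab (R + B + B' + 2 * δ)
    refine ⟨p, q, fun n hn m hm => ?_⟩
    have h1 := ha.dist_sub_le_product hn
    have h2 := hb.dist_sub_le_product hm
    have h3 := gromovProduct_le_left o (a ^ p • o) (b ^ q • o)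
    have h4 := gromovProduct_le_right o (a ^ p • o) (b ^ q • o)
    rw [gromovProduct_comm] at h1
    have h6 := hX.le_product (r := R + δ) (show R + δ ≤ gromovProduct o (a ^ n • o) (b ^ q • o) by
      have := hX.le_product (r := R + 2 * δ) (p := o) (x := a ^ n • o) (y := a ^ p • o)
        (z := b ^ q • o) (by linarith) (by linarith)
      linarith) (show R + δ ≤ gromovProduct o (b ^ q • o) (b ^ m • o) by linarith)
    linarith
  obtain ⟨γ, h0, hγ⟩ := hX.exists_ray_of_product hgeod o (x := fun n => a ^ n • o) fun R => by
    obtain ⟨N, hN⟩ := exists_nat_ge (R + B)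
    have aux : ∀ n m : ℕ, N ≤ n → n ≤ m → R ≤ gromovProduct o (a ^ n • o) (a ^ m • o) := by
      intro n m hn hnm
      have h1 := ha.dist_sub_le_product hnm
      have h2 := ha.le_dist n
      have h3 : (N : ℝ) ≤ n := by exact_mod_cast hn
      linarith
    refine ⟨N, fun n hn m hm => ?_⟩
    rcases le_total n m with h | h
    · exact aux n m hn h
    · rw [gromovProduct_comm]; exact aux m n hm h
  have hγ' : ConvergesToBoundary (fun n => b ^ n • o) γ.endpoint := by
    refine convergesToBoundary_of_exists_product fun R => ?_
    obtain ⟨p, q, hpq⟩ := key (R + δ)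
    obtain ⟨N, T, hN⟩ := hγ.exists_product o (R + δ)
    refine ⟨q, T, fun n hn t ht => ?_⟩
    have h1 := hpq (max p N) (le_max_left _ _) n hn
    have h2 := hN (max p N) (le_max_right _ _) t ht
    rw [gromovProduct_comm] at h1
    have := hX.le_product h1 h2
    rw [h0]; linarith
  refine ⟨_, hX.boundaryMap_eq hγ (K := dist o (g • o)) fun n => ?_,
    hX.boundaryMap_eq hγ' (K := dist o (h • o)) fun n => ?_⟩
  · rw [smul_smul, ← (hag.pow_left n).eq, mul_smul, dist_smul]
  · rw [smul_smul, ← (hbh.pow_left n).eq, mul_smul, dist_smul]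

end Loxodromic

/-! ### Ping-pong and five expanding words -/

section Separation

variable {Γ X : Type*} [Group Γ] [MetricSpace X] [MulAction Γ X] [IsIsometricSMul Γ X] {δ : ℝ}

/-- The point a^n b^Q o points towards a^n o, while b^Q o does not. The bound does not depend on
`Q`, which can therefore be chosen last. -/
theorem FourPoint.product_pow_smul_le (hX : FourPoint X δ) {o : X} {a b : Γ} {A : ℝ}
    (h : ∀ p q : ℕ, gromovProduct o (a ^ p • o) (b ^ q • o) ≤ A)
    (h' : ∀ p q : ℕ, gromovProduct o (a⁻¹ ^ p • o) (b ^ q • o) ≤ A) {n : ℕ}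
    (hn : 2 * A + δ < dist o (a ^ n • o)) (Q : ℕ) :
    gromovProduct o (b ^ Q • o) (a ^ n • b ^ Q • o) ≤ A + δ := by
  refine hX.product_le (z := a ^ n • o) (by rw [gromovProduct_comm]; exact h n Q) ?_
  have h1 := gromovProduct_add_gromovProduct o (a ^ n • o) (a ^ n • b ^ Q • o)
  have h2 := h' n Q
  rw [← gromovProduct_smul (a ^ n), smul_smul, inv_pow, mul_inv_cancel, one_smul] at h2
  rw [gromovProduct_comm]
  linarith

/-- After translation the left factors differ by a nontrivial power of `a ^ P`, and
`product_pow_smul_le` applies. Dropping the two right factors and moving the base point cost `D`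
each. -/
theorem FourPoint.product_words_le (hX : FourPoint X δ) {o : X} {a b : Γ} {A D : ℝ}
    (h : ∀ p q : ℕ, gromovProduct o (a ^ p • o) (b ^ q • o) ≤ A)
    (h' : ∀ p q : ℕ, gromovProduct o (a⁻¹ ^ p • o) (b ^ q • o) ≤ A) {P M : ℕ}
    (hP : ∀ i : ℕ, 0 < i → 2 * A + δ < dist o (a ^ (i * P) • o))
    (hD : ∀ i ≤ M, dist o (a ^ (i * P) • o) ≤ D) (Q : ℕ) {i i' j j' : ℕ} (hi : i ≤ M)
    (hi' : i' ≤ M) (hj : j ≤ M) (hj' : j' ≤ M) (hij : i ≠ j) :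
    gromovProduct o ((a ^ (i * P) * b ^ Q * a ^ (i' * P)) • o)
      ((a ^ (j * P) * b ^ Q * a ^ (j' * P)) • o) ≤ A + δ + 3 * D := by
  wlog hlt : i < j generalizing i j i' j'
  · rw [gromovProduct_comm]
    exact this hj hj' hi hi' hij.symm (by omega)
  have h1 := gromovProduct_le_add_dist_left o ((a ^ (i * P) * b ^ Q * a ^ (i' * P)) • o)
    ((a ^ (i * P) * b ^ Q) • o) ((a ^ (j * P) * b ^ Q * a ^ (j' * P)) • o)
  have h2 := gromovProduct_le_add_dist_right o ((a ^ (i * P) * b ^ Q) • o)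
    ((a ^ (j * P) * b ^ Q * a ^ (j' * P)) • o) ((a ^ (j * P) * b ^ Q) • o)
  have h3 := gromovProduct_le_add_dist_base o (a ^ (i * P) • o) ((a ^ (i * P) * b ^ Q) • o)
    ((a ^ (j * P) * b ^ Q) • o)
  have h4 := hX.product_pow_smul_le h h' (hP (j - i) (by omega)) Q
  rw [← gromovProduct_smul (a ^ (i * P)), smul_smul, smul_smul, smul_smul,
    ← pow_add, ← add_mul, Nat.add_sub_cancel' hlt.le] at h4
  rw [mul_smul _ (a ^ (i' * P)), dist_smul, dist_comm] at h1
  rw [mul_smul _ (a ^ (j' * P)), dist_smul, dist_comm] at h2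
  rw [← mul_smul] at h2
  rw [← mul_smul] at h1
  linarith [hD i hi, hD i' hi', hD j' hj']

theorem abs_dist_word_sub_le {o : X} {u v w : Γ} {D : ℝ} (hu : dist o (u • o) ≤ D)
    (hw : dist o (w • o) ≤ D) : |dist o ((u * v * w) • o) - dist o (v • o)| ≤ 2 * D := by
  have h1 := dist_triangle4 o (u • o) ((u * v) • o) ((u * v * w) • o)
  have h2 := dist_triangle4 (u • o) o ((u * v * w) • o) ((u * v) • o)
  have h3 : dist (u • o) ((u * v) • o) = dist o (v • o) := by rw [mul_smul, dist_smul]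
  have h4 : dist ((u * v) • o) ((u * v * w) • o) = dist o (w • o) := by
    rw [mul_smul (u * v), dist_smul]
  rw [dist_comm ((u * v * w) • o), dist_comm (u • o) o] at h2
  rw [abs_le]
  constructor <;> linarith

/-- Five isometries moving `o` far in pairwise separated directions, with inverses in pairwise
separated directions, increase distances on average. -/
theorem FourPoint.sum_dist_smul_ge (hX : FourPoint X δ) {o : X} {s : Fin 5 → Γ} {C D H : ℝ}
    (h : ∀ i j, i ≠ j → gromovProduct o (s i • o) (s j • o) ≤ C)
    (h' : ∀ i j, i ≠ j → gromovProduct o ((s i)⁻¹ • o) ((s j)⁻¹ • o) ≤ C)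
    (hs : ∀ i, |dist o (s i • o) - H| ≤ D)
    (hH : 5 * D + 12 * (C + δ) + 6 * δ + 5 ≤ H) (y z : X) :
    5 * (dist o z + 1) ≤ ∑ i, dist (s i • y) z := by
  have hδ := hX.nonneg
  have hC : 0 ≤ C := (gromovProduct_nonneg _ _ _).trans (h 0 1 (by decide))
  have hD : 0 ≤ D := (abs_nonneg _).trans (hs 0)
  -- In pairwise separated directions, at most one can be close to a given point. Hence at most two
  -- indices are bad, one because of `z` and one because of `y`; the three others gain `G` each, and
  -- 3G - 2E is large since both G and E contain `H` once.
  have exc : ∀ (f : Fin 5 → X) (x : X), (∀ i j, i ≠ j → gromovProduct o (f i) (f j) ≤ C) →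
      ∃ i, ∀ j, j ≠ i → gromovProduct o x (f j) ≤ C + δ := by
    intro f x hf
    by_cases hx : ∃ i, C + δ < gromovProduct o x (f i)
    · obtain ⟨i, hi⟩ := hx
      refine ⟨i, fun j hj => ?_⟩
      rw [gromovProduct_comm]
      exact hX.product_le (hf j i hj) hi
    · push Not at hx
      exact ⟨0, fun j _ => hx j⟩
  obtain ⟨i₁, h₁⟩ := exc (fun i => s i • o) z h
  obtain ⟨i₂, h₂⟩ := exc (fun i => (s i)⁻¹ • o) y h'
  set G := dist o y + (H - D) - 4 * (C + δ) - 2 * δ with hG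
  set E := dist o y + (H + D) with hE
  have e0 : 0 ≤ dist o y := dist_nonneg
  have hGE : 0 ≤ G + E := by linarith
  have lower : ∀ i, dist o z + G - (if i = i₁ then G + E else 0) - (if i = i₂ then G + E else 0)
      ≤ dist (s i • y) z := by
    intro i
    obtain ⟨hs1, hs2⟩ := abs_le.1 (hs i)
    have bad : dist o z - E ≤ dist (s i • y) z := by
      have h3 := dist_triangle4 o (s i • o) (s i • y) z
      rw [dist_smul] at h3
      linarith
    split_ifs with hi1 hi2 hi2
    · linarith
    · linarith
    · linarith
    · have h3 := h₁ i hi1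
      have h4 := h₂ i hi2
      have h5 : gromovProduct (s i • o) (s i • y) z ≤ C + δ + δ := by
        refine hX.product_le (z := o) ?_ ?_
        · rwa [← gromovProduct_smul (s i), smul_inv_smul] at h4
        · have h6 := gromovProduct_add_gromovProduct o (s i • o) z
          rw [gromovProduct_comm o, gromovProduct_comm (s i • o)] at h6
          linarith
      unfold gromovProduct at h3 h5
      rw [dist_smul] at h5
      rw [dist_comm z] at h3
      linarith
  have hsum := Finset.sum_le_sum fun i (_ : i ∈ Finset.univ) => lower i
  simp only [Finset.sum_sub_distrib, Finset.sum_const, Finset.card_univ, Fintype.card_fin,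
    Finset.sum_ite_eq', Finset.mem_univ, if_true, nsmul_eq_mul] at hsum
  push_cast at hsum
  linarith

/-- A non-elementary action has five elements, each a product of the same numbers of `g` and `h`,
that increase distances on average. -/
theorem IsNonElementary.exists_expanding [ProperSpace X] (hgeod : IsGeodesicSpace X)
    (hX : FourPoint X δ) (hne : IsNonElementary Γ X) (o : X) :
    ∃ (g h : Γ) (P Q : ℕ), ∀ y z : X, 5 * (dist o z + 1) ≤
      ∑ i : Fin 5, dist ((g ^ ((i : ℕ) * P) * h ^ Q * g ^ ((5 - (i : ℕ)) * P)) • y) z := by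
  obtain ⟨g, h, hg, hh, hfix⟩ := hne
  obtain ⟨k, hk⟩ := hg.exists_pow o (4 * δ + 2)
  obtain ⟨l, hl⟩ := hh.exists_pow o (4 * δ + 2)
  have ha := hX.isAxial o _ hk
  have hb := hX.isAxial o _ hl
  set a := g ^ k
  set b := h ^ l
  have hag : Commute a g := Commute.pow_self g k
  have hbh : Commute b h := Commute.pow_self h l
  -- Needed for all four choices of signs: the words and their inverses must both be separated.
  have bdd : ∀ {a b : Γ} {B B' : ℝ}, IsAxial o a B → IsAxial o b B' → Commute a g → Commute b h →
      ∃ A : ℝ, ∀ p q : ℕ, gromovProduct o (a ^ p • o) (b ^ q • o) ≤ A := by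
    intro a b B B' ha hb hag hbh
    by_contra! hc
    obtain ⟨ξ, hξ⟩ := hX.exists_common_fixed_point hgeod ha hb hag hbh hc
    exact hfix ξ hξ
  obtain ⟨A₁, h₁⟩ := bdd ha hb hag hbh
  obtain ⟨A₂, h₂⟩ := bdd ha.inv hb hag.inv_left hbh
  obtain ⟨A₃, h₃⟩ := bdd ha hb.inv hag hbh.inv_left
  obtain ⟨A₄, h₄⟩ := bdd ha.inv hb.inv hag.inv_left hbh.inv_left
  obtain ⟨A, hA₁, hA₂, hA₃, hA₄⟩ : ∃ A, A₁ ≤ A ∧ A₂ ≤ A ∧ A₃ ≤ A ∧ A₄ ≤ A :=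
    ⟨max (max A₁ A₂) (max A₃ A₄), by simp, by simp, by simp, by simp⟩
  obtain ⟨P, hP⟩ := exists_nat_gt (2 * A + δ)
  have hPa : ∀ i : ℕ, 0 < i → 2 * A + δ < dist o (a ^ (i * P) • o) := fun i hi => by
    refine lt_of_lt_of_le (hP.trans_le ?_) (ha.le_dist _)
    exact_mod_cast Nat.le_mul_of_pos_left P hi
  have hPa' : ∀ i : ℕ, 0 < i → 2 * A + δ < dist o (a⁻¹ ^ (i * P) • o) := fun i hi => by
    rw [inv_pow, dist_inv_smul_self]; exact hPa i hi
  set D : ℝ := (5 * P : ℕ) * dist o (a • o) with hD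
  have hDa : ∀ i ≤ 5, dist o (a ^ (i * P) • o) ≤ D := fun i hi => by
    refine (dist_pow_smul_le a o _).trans ?_
    refine mul_le_mul_of_nonneg_right ?_ dist_nonneg
    exact_mod_cast Nat.mul_le_mul_right P hi
  have hDa' : ∀ i ≤ 5, dist o (a⁻¹ ^ (i * P) • o) ≤ D := fun i hi => by
    rw [inv_pow, dist_inv_smul_self]; exact hDa i hi
  -- `A`, `P` and `D` are already fixed, so the middle factor b^Q can be made long enough to
  -- dominate every error.
  obtain ⟨Q, hQ⟩ := exists_nat_ge (5 * (2 * D) + 12 * (A + δ + 3 * D + δ) + 6 * δ + 5)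
  refine ⟨g, h, k * P, l * Q, fun y z => ?_⟩
  have := hX.sum_dist_smul_ge (o := o)
    (s := fun i : Fin 5 => a ^ ((i : ℕ) * P) * b ^ Q * a ^ ((5 - (i : ℕ)) * P))
    (C := A + δ + 3 * D) (D := 2 * D) (H := dist o (b ^ Q • o)) ?_ ?_ ?_ ?_ y z
  · have e : ∀ i : ℕ, a ^ (i * P) = g ^ (i * (k * P)) := fun i => by
      rw [← pow_mul]; congr 1; ring
    simpa only [e, b, ← pow_mul] using this
  · intro i j hij
    exact hX.product_words_le (fun p q => (h₁ p q).trans hA₁) (fun p q => (h₂ p q).trans hA₂)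
      hPa hDa Q (by omega) (by omega) (by omega) (by omega) (by omega)
  · intro i j hij
    have := hX.product_words_le (fun p q => (h₄ p q).trans hA₄)
      (fun p q => by rw [inv_inv]; exact (h₃ p q).trans hA₃)
      hPa' hDa' Q (i := 5 - (i : ℕ)) (i' := i) (j := 5 - (j : ℕ)) (j' := j)
      (by omega) (by omega) (by omega) (by omega) (by omega)
    simpa only [mul_inv_rev, inv_pow, mul_assoc] using this
  · intro i
    exact abs_dist_word_sub_le (hDa _ (by omega)) (hDa _ (by omega))
  · exact hQ.trans (hb.le_dist Q)

end Separation

/-! ### Convolution powers of the step distribution -/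

section StepLaw

variable {Γ : Type*} [Group Γ] [Countable Γ] [MeasurableSpace Γ] [DiscreteMeasurableSpace Γ]

/-- The law of the product of `n` independent elements with law `μ`. -/
noncomputable def stepLaw (μ : Measure Γ) : ℕ → Measure Γ
  | 0 => Measure.dirac 1
  | n + 1 => stepLaw μ n ∗ₘ μ

instance stepLaw.isProbabilityMeasure (μ : Measure Γ) [IsProbabilityMeasure μ] (n : ℕ) :
    IsProbabilityMeasure (stepLaw μ n) := by
  induction n with
  | zero => unfold stepLaw; infer_instance
  | succ n ih => unfold stepLaw; infer_instance

theorem stepLaw_add (μ : Measure Γ) [IsProbabilityMeasure μ] (m n : ℕ) :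
    stepLaw μ (m + n) = stepLaw μ m ∗ₘ stepLaw μ n := by
  induction n with
  | zero => simp [stepLaw]
  | succ n ih => rw [← add_assoc, stepLaw, ih, stepLaw, Measure.mconv_assoc]

theorem stepLaw_one (μ : Measure Γ) [IsProbabilityMeasure μ] : stepLaw μ 1 = μ := by
  simp [stepLaw]

theorem stepLaw_stepLaw (μ : Measure Γ) [IsProbabilityMeasure μ] (m n : ℕ) :
    stepLaw (stepLaw μ m) n = stepLaw μ (m * n) := by
  induction n with
  | zero => simp [stepLaw]
  | succ n ih => rw [stepLaw, ih, mul_add, mul_one, stepLaw_add]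

theorem mul_le_stepLaw_add (μ : Measure Γ) [IsProbabilityMeasure μ] (m n : ℕ) (g h : Γ) :
    stepLaw μ m {g} * stepLaw μ n {h} ≤ stepLaw μ (m + n) {g * h} := by
  rw [stepLaw_add, Measure.mconv, Measure.map_apply measurable_mul (measurableSet_singleton _),
    ← Measure.prod_prod]
  refine measure_mono ?_
  rintro ⟨x, y⟩ ⟨hx, hy⟩
  simp_all

theorem stepLaw_mul_ne_zero {μ : Measure Γ} [IsProbabilityMeasure μ] {m n : ℕ} {g h : Γ}
    (hg : stepLaw μ m {g} ≠ 0) (hh : stepLaw μ n {h} ≠ 0) : stepLaw μ (m + n) {g * h} ≠ 0 :=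
  fun h0 => mul_ne_zero hg hh (le_zero_iff.1 ((mul_le_stepLaw_add μ m n g h).trans h0.le))

theorem stepLaw_pow_ne_zero {μ : Measure Γ} [IsProbabilityMeasure μ] {m : ℕ} {g : Γ}
    (hg : stepLaw μ m {g} ≠ 0) (k : ℕ) : stepLaw μ (k * m) {g ^ k} ≠ 0 := by
  induction k with
  | zero => simp [stepLaw]
  | succ k ih => rw [add_mul, one_mul, pow_succ]; exact stepLaw_mul_ne_zero ih hg

theorem GeneratesAsSemigroup.exists_stepLaw_ne_zero {μ : Measure Γ} [IsProbabilityMeasure μ]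
    (h : GeneratesAsSemigroup μ) (g : Γ) : ∃ m, stepLaw μ m {g} ≠ 0 := by
  have hg : g ∈ Subsemigroup.closure {g : Γ | μ {g} ≠ 0} := by
    rw [show Subsemigroup.closure {g : Γ | μ {g} ≠ 0} = ⊤ from h]; trivial
  induction hg using Subsemigroup.closure_induction with
  | mem x hx => exact ⟨1, by rwa [stepLaw_one]⟩
  | mul x y _ _ hx hy =>
    obtain ⟨m, hm⟩ := hx
    obtain ⟨n, hn⟩ := hy
    exact ⟨m + n, stepLaw_mul_ne_zero hm hn⟩

theorem mul_le_integral_of_le_real {ρ : Measure Γ} [IsProbabilityMeasure ρ] {f : Γ → ℝ}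
    (hf : Integrable f ρ) (h0 : ∀ g, 0 ≤ f g) {p : ℝ} {s : Γ} (hp : p ≤ ρ.real {s}) :
    p * f s ≤ ∫ g, f g ∂ρ := by
  refine (mul_le_mul_of_nonneg_right hp (h0 s)).trans ?_
  have := setIntegral_le_integral (s := {s}) hf (Eventually.of_forall h0)
  rwa [integral_singleton, smul_eq_mul] at this

end StepLaw

/-! ### Linear drift, uniformly in the target point -/

section Drift

variable {Γ X : Type*} [Group Γ] [Countable Γ] [MeasurableSpace Γ] [DiscreteMeasurableSpace Γ]
  [MetricSpace X] [MulAction Γ X] [IsIsometricSMul Γ X]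

/-- The expected distance to `z` of the random walk at time `n`. -/
noncomputable def expectedDist (ρ : Measure Γ) (o : X) (n : ℕ) (z : X) : ℝ :=
  ∫ g, dist (g • o) z ∂(stepLaw ρ n)

variable {ρ : Measure Γ} [IsProbabilityMeasure ρ] {o : X}

theorem integrable_dist_smul {ν : Measure Γ} [IsProbabilityMeasure ν]
    (h : Integrable (fun g => dist o (g • o)) ν) (z : X) :
    Integrable (fun g => dist (g • o) z) ν := by
  refine ((integrable_const (dist o z)).add h).mono' (Measurable.of_discrete).aestronglyMeasurable
    (Eventually.of_forall fun g => ?_)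
  rw [Real.norm_of_nonneg dist_nonneg]
  have := dist_triangle (g • o) o z
  rw [dist_comm (g • o) o] at this
  simp only [Pi.add_apply]
  linarith

theorem expectedDist_zero (z : X) : expectedDist ρ o 0 z = dist o z := by
  simp [expectedDist, stepLaw]

variable (hint : ∀ n, Integrable (fun g => dist o (g • o)) (stepLaw ρ n))
include hint

theorem expectedDist_le (n : ℕ) (z : X) :
    expectedDist ρ o n z ≤ expectedDist ρ o n o + dist o z := by
  have h : expectedDist ρ o n o + dist o z
      = ∫ g, (dist (g • o) o + dist o z) ∂(stepLaw ρ n) := by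
    rw [integral_add (integrable_dist_smul (hint n) o) (integrable_const _)]
    simp [expectedDist]
  rw [h]
  exact integral_mono (integrable_dist_smul (hint n) z)
    ((integrable_dist_smul (hint n) o).add (integrable_const _)) fun g => dist_triangle _ _ _

theorem integrable_dist_base : Integrable (fun g => dist o (g • o)) ρ := by
  have := hint 1
  rwa [stepLaw_one] at this

theorem integrable_expectedDist (n : ℕ) (w : X) :
    Integrable (fun h : Γ => expectedDist ρ o n (h⁻¹ • w)) ρ := by
  refine ((integrable_const (expectedDist ρ o n o)).add
    (integrable_dist_smul (integrable_dist_base hint) w)).mono'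
    (Measurable.of_discrete).aestronglyMeasurable (Eventually.of_forall fun h => ?_)
  have h0 : 0 ≤ expectedDist ρ o n (h⁻¹ • w) := integral_nonneg fun _ => dist_nonneg
  rw [Real.norm_of_nonneg h0]
  have := expectedDist_le hint n (h⁻¹ • w)
  rwa [← dist_smul_eq_dist_inv_smul] at this

theorem expectedDist_succ (n : ℕ) (z : X) :
    expectedDist ρ o (n + 1) z = ∫ h, expectedDist ρ o n (h⁻¹ • z) ∂ρ := by
  have h1 : stepLaw ρ (n + 1) = ρ ∗ₘ stepLaw ρ n := by
    rw [add_comm, stepLaw_add, stepLaw_one]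
  have h2 := integrable_dist_smul (hint (n + 1)) z
  unfold expectedDist
  rw [h1] at h2 ⊢
  rw [integral_mconv h2]
  simp only [mul_smul, dist_smul_eq_dist_inv_smul]

variable {s : Fin 5 → Γ} {p : ℝ} (hp : 0 < p) (hs : ∀ i, p ≤ ρ.real {s i})
  (hexp : ∀ y z : X, 5 * (dist o z + 1) ≤ ∑ i, dist (s i • y) z)
include hp hs hexp

/-- The arbitrary `g` between the expanding letter and the walk is what makes the induction run: a
next step `h` is absorbed into `g * h` without loss. When `h` is itself one of the `s j`, averaging
a second time gives an extra gain, and this happens with probability at least `p` for each `j`. -/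
theorem sum_expectedDist_ge (n : ℕ) (g : Γ) (z : X) :
    5 * (dist o z + 1 + p * n) ≤ ∑ i, expectedDist ρ o n ((s i * g)⁻¹ • z) := by
  induction n generalizing g z with
  | zero =>
    simp only [expectedDist_zero, ← dist_smul_eq_dist_inv_smul, mul_smul]
    simpa using hexp (g • o) z
  | succ n ih =>
    set f : Γ → ℝ := fun h => (∑ i, expectedDist ρ o n (h⁻¹ • (s i * g)⁻¹ • z)) -
      5 * (dist o z + 1 + p * n) with hf
    have e : ∀ (i : Fin 5) (h : Γ), h⁻¹ • (s i * g)⁻¹ • z = (s i * (g * h))⁻¹ • z := fun i h => by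
      rw [smul_smul]; congr 1; group
    have hf0 : ∀ h, 0 ≤ f h := fun h => by
      have := ih (g * h) z
      simp only [hf, e]
      linarith
    have hsum : Integrable (fun h : Γ => ∑ i, expectedDist ρ o n (h⁻¹ • (s i * g)⁻¹ • z)) ρ :=
      integrable_finsetSum _ fun i _ => integrable_expectedDist hint n _
    have hfi : Integrable f ρ := hsum.sub (integrable_const _)
    have hI : ∫ h, f h ∂ρ = (∑ i, expectedDist ρ o (n + 1) ((s i * g)⁻¹ • z)) -
        5 * (dist o z + 1 + p * n) := by
      rw [integral_sub hsum (integrable_const _),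
        integral_finsetSum _ fun i _ => integrable_expectedDist hint n _]
      simp [expectedDist_succ hint]
    have h1 : ∑ j, p * f (s j) ≤ ∑ j : Fin 5, ∫ h, f h ∂ρ :=
      Finset.sum_le_sum fun j _ => mul_le_integral_of_le_real hfi hf0 (hs j)
    have h2 : (25 : ℝ) ≤ ∑ j, f (s j) := by
      have h3 : ∑ i, 5 * (dist o ((s i * g)⁻¹ • z) + 1 + p * n) ≤
          ∑ i, ∑ j, expectedDist ρ o n ((s j)⁻¹ • (s i * g)⁻¹ • z) :=
        Finset.sum_le_sum fun i _ => by simpa using ih 1 ((s i * g)⁻¹ • z)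
      have h4 := hexp (g • o) z
      simp only [← dist_smul_eq_dist_inv_smul, mul_smul, ← Finset.mul_sum, Finset.sum_add_distrib,
        Finset.sum_const, Finset.card_univ, Fintype.card_fin, nsmul_eq_mul] at h3
      simp only [hf, Finset.sum_sub_distrib, Finset.sum_const, Finset.card_univ, Fintype.card_fin,
        nsmul_eq_mul, mul_inv_rev, mul_smul]
      rw [Finset.sum_comm]
      simp only [mul_inv_rev, mul_smul] at h3
      push_cast at h3 ⊢
      linarith
    rw [← Finset.mul_sum, Finset.sum_const, Finset.card_univ, Fintype.card_fin, nsmul_eq_mul,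
      hI] at h1
    have h5 := mul_le_mul_of_nonneg_left h2 hp.le
    push_cast at h1 ⊢
    linarith

/-- The expected distance of the random walk to any point grows linearly. -/
theorem expectedDist_ge (n : ℕ) (z : X) :
    dist o z - (∫ h, dist o (h • o) ∂ρ) / p + p * n ≤ expectedDist ρ o n z := by
  -- Conditioning on the first step loses `K` on average through the triangle inequality. The offset
  -- `K / p` is chosen so that the five expanding letters, which do not suffer it, pay for this
  -- loss.
  set K := ∫ h, dist o (h • o) ∂ρ with hK
  have hK0 : 0 ≤ K := integral_nonneg fun _ => dist_nonneg
  induction n generalizing z with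
  | zero =>
    have := div_nonneg hK0 hp.le
    rw [expectedDist_zero]
    simp only [Nat.cast_zero, mul_zero]
    linarith
  | succ n ih =>
    have hd := integrable_dist_base hint
    set f : Γ → ℝ := fun h => (expectedDist ρ o n (h⁻¹ • z) + dist o (h • o)) -
      (dist o z - K / p + p * n) with hf
    have hf0 : ∀ h, 0 ≤ f h := fun h => by
      have h1 := ih (h⁻¹ • z)
      rw [← dist_smul_eq_dist_inv_smul] at h1
      have h2 := dist_triangle o (h • o) z
      simp only [hf]
      linarith
    have hi := integrable_expectedDist hint n z
    have hfi : Integrable f ρ := (hi.add hd).sub (integrable_const _)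
    have hI : ∫ h, f h ∂ρ = expectedDist ρ o (n + 1) z + K - (dist o z - K / p + p * n) := by
      have h1 := integral_sub (hi.add hd) (integrable_const (dist o z - K / p + p * n))
      simp only [Pi.add_apply] at h1
      rw [h1, integral_add hi hd, expectedDist_succ hint]
      simp [hK]
    have h1 : ∑ j, p * f (s j) ≤ ∑ j : Fin 5, ∫ h, f h ∂ρ :=
      Finset.sum_le_sum fun j _ => mul_le_integral_of_le_real hfi hf0 (hs j)
    have h2 : 5 + 5 * (K / p) ≤ ∑ j, f (s j) := by
      have h3 := sum_expectedDist_ge hint hp hs hexp n 1 z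
      have h4 : 0 ≤ ∑ j, dist o (s j • o) := Finset.sum_nonneg fun _ _ => dist_nonneg
      simp only [mul_one] at h3
      simp only [hf, Finset.sum_sub_distrib, Finset.sum_add_distrib, Finset.sum_const,
        Finset.card_univ, Fintype.card_fin, nsmul_eq_mul]
      push_cast
      linarith
    rw [← Finset.mul_sum, Finset.sum_const, Finset.card_univ, Fintype.card_fin, nsmul_eq_mul,
      hI] at h1
    have h5 := mul_le_mul_of_nonneg_left h2 hp.le
    have h6 : p * (5 + 5 * (K / p)) = 5 * p + 5 * K := by field_simp
    push_cast at h1 ⊢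
    linarith

end Drift

/-! ### Exponential estimates -/

section ExpENNReal

/-- The exponential as an extended nonnegative real. -/
noncomputable def eexp (x : ℝ) : ℝ≥0∞ := ENNReal.ofReal (Real.exp x)

theorem eexp_add (x y : ℝ) : eexp (x + y) = eexp x * eexp y := by
  rw [eexp, Real.exp_add, ENNReal.ofReal_mul (Real.exp_pos x).le]; rfl

theorem eexp_zero : eexp 0 = 1 := by simp [eexp]

theorem eexp_le {x y : ℝ} (h : x ≤ y) : eexp x ≤ eexp y :=
  ENNReal.ofReal_le_ofReal (Real.exp_le_exp.2 h)

theorem eexp_ne_top (x : ℝ) : eexp x ≠ ∞ := ENNReal.ofReal_ne_top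

/-- A second-order Taylor bound. Half of the exponent `t` absorbs the quadratic factor `y ^ 2`, the
other half the exponential in the remainder. -/
theorem exp_neg_mul_le {t ε x y : ℝ} (ht : 0 < t) (hε : 0 ≤ ε) (hεt : ε ≤ t / 2) (hxy : |x| ≤ y) :
    Real.exp (-(ε * x)) ≤ 1 - ε * x + ε ^ 2 * (8 / t ^ 2 * Real.exp (t * y)) := by
  have hy : 0 ≤ y := (abs_nonneg x).trans hxy
  have h1 : ∀ u : ℝ, Real.exp u ≤ 1 + u + u ^ 2 * Real.exp |u| := by
    intro u
    have hu1 : 1 ≤ Real.exp |u| := Real.one_le_exp (abs_nonneg u)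
    rcases le_or_gt |u| 1 with h | h
    · have h2 := (abs_le.1 (Real.abs_exp_sub_one_sub_id_le h)).2
      have h3 : u ^ 2 * 1 ≤ u ^ 2 * Real.exp |u| := mul_le_mul_of_nonneg_left hu1 (sq_nonneg u)
      linarith
    · have h2 : Real.exp u ≤ Real.exp |u| := Real.exp_le_exp.2 (le_abs_self u)
      have h3 := neg_abs_le u
      have h4 : (|u| - 1) * 1 ≤ (|u| - 1) * ((|u| + 1) * Real.exp |u|) := by
        refine mul_le_mul_of_nonneg_left ?_ (by linarith)
        nlinarith
      have h5 : (|u| - 1) * ((|u| + 1) * Real.exp |u|) = u ^ 2 * Real.exp |u| - Real.exp |u| := by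
        rw [← sq_abs u]; ring
      linarith
  have h2 : y ^ 2 ≤ 8 / t ^ 2 * Real.exp (t / 2 * y) := by
    have h3 := Real.quadratic_le_exp_of_nonneg (x := t / 2 * y) (by positivity)
    have h4 : (t / 2 * y) ^ 2 / 2 ≤ Real.exp (t / 2 * y) := by
      have : 0 ≤ t / 2 * y := by positivity
      linarith
    rw [div_mul_eq_mul_div, le_div_iff₀ (by positivity)]
    linarith
  have h3 : |-(ε * x)| ≤ t / 2 * y := by
    rw [abs_neg, abs_mul, abs_of_nonneg hε]
    exact mul_le_mul hεt hxy (abs_nonneg _) (by positivity)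
  have h4 : (-(ε * x)) ^ 2 ≤ ε ^ 2 * (8 / t ^ 2 * Real.exp (t / 2 * y)) := by
    rw [neg_sq, mul_pow]
    refine mul_le_mul_of_nonneg_left ((sq_le_sq' ?_ (abs_le.1 hxy).2).trans h2) (sq_nonneg ε)
    exact (abs_le.1 hxy).1
  have h5 := mul_le_mul h4 (Real.exp_le_exp.2 h3) (Real.exp_pos _).le (by positivity)
  have h6 : Real.exp (t / 2 * y) * Real.exp (t / 2 * y) = Real.exp (t * y) := by
    rw [← Real.exp_add]; congr 1; ring
  calc _ ≤ _ := h1 _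
    _ ≤ 1 + -(ε * x) + ε ^ 2 * (8 / t ^ 2 * Real.exp (t / 2 * y)) * Real.exp (t / 2 * y) := by
      linarith
    _ = _ := by rw [← h6]; ring

end ExpENNReal

/-! ### Contraction of exponential moments -/

section ExponentialMoments

variable {Γ X : Type*} [Group Γ] [Countable Γ] [MeasurableSpace Γ] [DiscreteMeasurableSpace Γ]
  [MetricSpace X] [MulAction Γ X] [IsIsometricSMul Γ X] {μ : Measure Γ} [IsProbabilityMeasure μ]
  {o : X} {t : ℝ}

theorem lintegral_exp_dist_lt_top (ht : 0 ≤ t)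
    (hμ : ∫⁻ g, eexp (t * dist o (g • o)) ∂μ < ∞) (n : ℕ) :
    ∫⁻ g, eexp (t * dist o (g • o)) ∂(stepLaw μ n) < ∞ := by
  induction n with
  | zero => simp [stepLaw, eexp]
  | succ n ih =>
    rw [stepLaw, Measure.lintegral_mconv Measurable.of_discrete]
    calc _ ≤ ∫⁻ x, ∫⁻ y, eexp (t * dist o (x • o)) * eexp (t * dist o (y • o)) ∂μ ∂(stepLaw μ n) := by
          refine lintegral_mono fun x => lintegral_mono fun y => ?_
          rw [← eexp_add, ← mul_add]
          refine eexp_le (mul_le_mul_of_nonneg_left ?_ ht)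
          have := dist_triangle o (x • o) ((x * y) • o)
          rw [mul_smul, dist_smul] at this
          rwa [mul_smul]
      _ = (∫⁻ x, eexp (t * dist o (x • o)) ∂(stepLaw μ n)) *
            ∫⁻ y, eexp (t * dist o (y • o)) ∂μ := by
          rw [← lintegral_mul_const _ Measurable.of_discrete]
          exact lintegral_congr fun x => lintegral_const_mul _ Measurable.of_discrete
      _ < ∞ := ENNReal.mul_lt_top ih hμ

theorem integrable_exp_dist {ν : Measure Γ}
    (hν : ∫⁻ g, eexp (t * dist o (g • o)) ∂ν < ∞) :
    Integrable (fun g => Real.exp (t * dist o (g • o))) ν := by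
  refine ⟨Measurable.of_discrete.aestronglyMeasurable, ?_⟩
  rw [hasFiniteIntegral_iff_ofReal (Eventually.of_forall fun g => (Real.exp_pos _).le)]
  exact hν

theorem integrable_dist_of_exp {ν : Measure Γ} (ht : 0 < t)
    (hν : ∫⁻ g, eexp (t * dist o (g • o)) ∂ν < ∞) :
    Integrable (fun g => dist o (g • o)) ν := by
  refine ((integrable_exp_dist hν).const_mul t⁻¹).mono'
    Measurable.of_discrete.aestronglyMeasurable (Eventually.of_forall fun g => ?_)
  rw [Real.norm_of_nonneg dist_nonneg, inv_mul_eq_div, le_div_iff₀ ht, mul_comm]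
  have := Real.add_one_le_exp (t * dist o (g • o))
  linarith

theorem abs_dist_smul_sub_le (g : Γ) (o z : X) :
    |dist (g • o) z - dist o z| ≤ dist o (g • o) := by
  rw [dist_comm o (g • o)]; exact abs_dist_sub_le _ _ _

/-- Uniform contraction: if distances to all points increase on average, then a small negative
exponential moment of the increments is less than one. -/
theorem exists_contraction_of_drift {ν : Measure Γ} [IsProbabilityMeasure ν] (ht : 0 < t)
    (hν : ∫⁻ g, eexp (t * dist o (g • o)) ∂ν < ∞)
    (hdrift : ∀ z : X, dist o z + 1 ≤ ∫ g, dist (g • o) z ∂ν) :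
    ∃ ε : ℝ, 0 < ε ∧ ε ≤ t ∧ ∀ z : X,
      ∫⁻ g, eexp (-(ε * (dist (g • o) z - dist o z))) ∂ν ≤ eexp (-(ε / 2)) := by
  have hi := integrable_exp_dist hν
  have hd := integrable_dist_of_exp ht hν
  set M := ∫ g, 8 / t ^ 2 * Real.exp (t * dist o (g • o)) ∂ν with hM
  have hM0 : 0 ≤ M := integral_nonneg fun _ => by positivity
  refine ⟨min (t / 2) (1 / (2 * M + 1)), by positivity, (min_le_left _ _).trans (by linarith),
    fun z => ?_⟩
  -- The moment is at most 1 - ε + ε² M, and ε M ≤ 1/2 bounds this by 1 - ε/2.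
  set ε := min (t / 2) (1 / (2 * M + 1)) with hε
  have hε0 : 0 < ε := by positivity
  have hεM : ε * (2 * M + 1) ≤ 1 := by
    rw [← le_div_iff₀ (by positivity)]; exact min_le_right _ _
  have hz := integrable_dist_smul hd z
  have hb : ∀ g : Γ, Real.exp (-(ε * (dist (g • o) z - dist o z))) ≤
      1 - ε * (dist (g • o) z - dist o z) +
        ε ^ 2 * (8 / t ^ 2 * Real.exp (t * dist o (g • o))) := fun g =>
    exp_neg_mul_le ht hε0.le (min_le_left _ _) (abs_dist_smul_sub_le g o z)
  have i1 : Integrable (fun g => ε * (dist (g • o) z - dist o z)) ν :=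
    (hz.sub (integrable_const _)).const_mul _
  have i2 : Integrable (fun g => 1 - ε * (dist (g • o) z - dist o z)) ν :=
    (integrable_const _).sub i1
  have i3 : Integrable (fun g => ε ^ 2 * (8 / t ^ 2 * Real.exp (t * dist o (g • o)))) ν :=
    (hi.const_mul _).const_mul _
  calc _ ≤ ∫⁻ g, ENNReal.ofReal (1 - ε * (dist (g • o) z - dist o z) +
        ε ^ 2 * (8 / t ^ 2 * Real.exp (t * dist o (g • o)))) ∂ν :=
        lintegral_mono fun g => ENNReal.ofReal_le_ofReal (hb g)
    _ = ENNReal.ofReal (∫ g, (1 - ε * (dist (g • o) z - dist o z) +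
        ε ^ 2 * (8 / t ^ 2 * Real.exp (t * dist o (g • o)))) ∂ν) :=
        (ofReal_integral_eq_lintegral_ofReal (i2.add i3)
          (Eventually.of_forall fun g => (Real.exp_pos _).le.trans (hb g))).symm
    _ ≤ _ := by
        refine ENNReal.ofReal_le_ofReal ?_
        rw [integral_add i2 i3, integral_sub (integrable_const _) i1, integral_const_mul,
          integral_const_mul, integral_sub hz (integrable_const _), ← hM]
        simp only [integral_const, probReal_univ, one_smul]
        have h1 := Real.add_one_le_exp (-(ε / 2))
        have h2 := mul_le_mul_of_nonneg_left (hdrift z) hε0.le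
        have h3 := mul_le_mul_of_nonneg_left hεM hε0.le
        nlinarith

/-- For a non-elementary action, the increments of distances along the random walk have a negative
exponential moment at most `1 / e ^ η`, uniformly. -/
theorem exists_contraction [ProperSpace X] (hgeod : IsGeodesicSpace X) {δ : ℝ}
    (hX : FourPoint X δ) (hne : IsNonElementary Γ X) (hgen : GeneratesAsSemigroup μ) (ht : 0 < t)
    (hμ : ∫⁻ g, eexp (t * dist o (g • o)) ∂μ < ∞) :
    ∃ (N : ℕ) (ε η : ℝ), 0 < ε ∧ ε ≤ t ∧ 0 < η ∧ ∀ z : X,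
      ∫⁻ g, eexp (-(ε * (dist (g • o) z - dist o z))) ∂(stepLaw μ N) ≤ eexp (-η) := by
  obtain ⟨g, h, P, Q, hexp⟩ := hne.exists_expanding hgeod hX o
  obtain ⟨a, ha⟩ := hgen.exists_stepLaw_ne_zero g
  obtain ⟨b, hb⟩ := hgen.exists_stepLaw_ne_zero h
  set s : Fin 5 → Γ := fun i => g ^ ((i : ℕ) * P) * h ^ Q * g ^ ((5 - (i : ℕ)) * P) with hs
  -- All five words use `g` and `h` equally often, so one convolution power charges them all, with
  -- no aperiodicity assumption.
  set m := 5 * P * a + Q * b with hm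
  have hpos : ∀ i, stepLaw μ m {s i} ≠ 0 := fun i => by
    have h1 := stepLaw_mul_ne_zero (stepLaw_mul_ne_zero (stepLaw_pow_ne_zero ha ((i : ℕ) * P))
      (stepLaw_pow_ne_zero hb Q)) (stepLaw_pow_ne_zero ha ((5 - (i : ℕ)) * P))
    have h2 : 5 * P = (i : ℕ) * P + (5 - (i : ℕ)) * P := by
      rw [← add_mul]; congr 1; omega
    have h3 : m = (i : ℕ) * P * a + Q * b + (5 - (i : ℕ)) * P * a := by
      rw [hm, h2]; ring
    rw [h3]
    exact h1
  obtain ⟨p, hp0, hp⟩ : ∃ p : ℝ, 0 < p ∧ ∀ i, p ≤ (stepLaw μ m).real {s i} := by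
    obtain ⟨i, hi⟩ := Finite.exists_min fun i => (stepLaw μ m).real {s i}
    exact ⟨_, ENNReal.toReal_pos (hpos i) (measure_ne_top _ _), hi⟩
  have hint : ∀ n, Integrable (fun g => dist o (g • o)) (stepLaw (stepLaw μ m) n) := fun n => by
    rw [stepLaw_stepLaw]
    exact integrable_dist_of_exp ht (lintegral_exp_dist_lt_top ht.le hμ _)
  obtain ⟨n, hn⟩ := exists_nat_ge ((1 + (∫ h, dist o (h • o) ∂(stepLaw μ m)) / p) / p)
  rw [div_le_iff₀ hp0] at hn
  obtain ⟨ε, hε, hεt, h⟩ := exists_contraction_of_drift (ν := stepLaw μ (m * n)) ht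
    (lintegral_exp_dist_lt_top ht.le hμ _) fun z => by
      have := expectedDist_ge hint hp0 hp hexp n z
      rw [expectedDist, stepLaw_stepLaw] at this
      linarith
  exact ⟨m * n, ε, ε / 2, hε, hεt, by positivity, h⟩

/-- The later steps are integrated first: as the bound on `F` is uniform in `z`, it applies at the
moved point `x⁻¹ • z`. -/
theorem lintegral_cocycle_mul {ν : Measure Γ} {ε : ℝ} (F : Γ → X → ℝ≥0∞) {c : ℝ≥0∞} {N : ℕ}
    [IsProbabilityMeasure ν]
    (h : ∀ z : X, ∫⁻ g, eexp (-(ε * (dist (g • o) z - dist o z))) ∂(stepLaw μ N) ≤ c) {B : ℝ≥0∞}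
    (hF : ∀ z, ∫⁻ g, F g z ∂ν ≤ B) (z : X) :
    ∫⁻ x, ∫⁻ y, eexp (-(ε * (dist (x • o) z - dist o z))) * F y (x⁻¹ • z) ∂ν ∂(stepLaw μ N)
      ≤ c * B := by
  calc _ ≤ ∫⁻ x, eexp (-(ε * (dist (x • o) z - dist o z))) * B ∂(stepLaw μ N) := by
        refine lintegral_mono fun x => ?_
        rw [lintegral_const_mul _ Measurable.of_discrete]
        exact mul_le_mul_right (hF _) _
    _ ≤ c * B := by
        rw [lintegral_mul_const _ Measurable.of_discrete]
        exact mul_le_mul_left (h z) _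

theorem lintegral_cocycle_add_le {ε : ℝ} {m n : ℕ} {c B : ℝ≥0∞}
    (h : ∀ z : X, ∫⁻ g, eexp (-(ε * (dist (g • o) z - dist o z))) ∂(stepLaw μ m) ≤ c)
    (h' : ∀ z : X, ∫⁻ g, eexp (-(ε * (dist (g • o) z - dist o z))) ∂(stepLaw μ n) ≤ B) (z : X) :
    ∫⁻ g, eexp (-(ε * (dist (g • o) z - dist o z))) ∂(stepLaw μ (m + n)) ≤ c * B := by
  rw [stepLaw_add, Measure.lintegral_mconv Measurable.of_discrete]
  refine le_trans (le_of_eq ?_) (lintegral_cocycle_mul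
    (fun g z => eexp (-(ε * (dist (g • o) z - dist o z)))) h h' z)
  refine lintegral_congr fun x => lintegral_congr fun y => ?_
  rw [← eexp_add, mul_smul, ← dist_smul_eq_dist_inv_smul x o z,
    dist_smul_eq_dist_inv_smul x (y • o) z]
  congr 1; ring

theorem lintegral_cocycle_mul_le {ε η : ℝ} {N : ℕ}
    (h : ∀ z : X, ∫⁻ g, eexp (-(ε * (dist (g • o) z - dist o z))) ∂(stepLaw μ N) ≤ eexp (-η))
    (j : ℕ) (z : X) :
    ∫⁻ g, eexp (-(ε * (dist (g • o) z - dist o z))) ∂(stepLaw μ (j * N)) ≤ eexp (-(j * η)) := by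
  induction j generalizing z with
  | zero => simp [stepLaw, eexp]
  | succ j ih =>
    rw [add_mul, one_mul]
    refine (lintegral_cocycle_add_le ih h z).trans_eq ?_
    rw [← eexp_add]; push_cast; congr 1; ring

theorem exists_lintegral_bound (ht : 0 ≤ t) (hμ : ∫⁻ g, eexp (t * dist o (g • o)) ∂μ < ∞)
    (K : ℕ) : ∃ T : ℝ≥0∞, T ≠ ∞ ∧ ∀ n ≤ K, ∀ ε ≤ t, ∀ f : Γ → ℝ, (∀ g, f g ≤ ε * dist o (g • o)) →
      ∫⁻ g, eexp (f g) ∂(stepLaw μ n) ≤ T := by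
  refine ⟨∑ n ∈ Finset.range (K + 1), ∫⁻ g, eexp (t * dist o (g • o)) ∂(stepLaw μ n),
    ENNReal.sum_ne_top.2 fun n _ => (lintegral_exp_dist_lt_top ht hμ n).ne, ?_⟩
  intro n hn ε hε f hf
  refine le_trans (lintegral_mono fun g => eexp_le ((hf g).trans
    (mul_le_mul_of_nonneg_right hε dist_nonneg))) ?_
  exact Finset.single_le_sum (f := fun n => ∫⁻ g, eexp (t * dist o (g • o)) ∂(stepLaw μ n))
    (fun _ _ => zero_le) (Finset.mem_range.2 (by omega))

/-- Uniform exponential moments of Gromov products along the random walk. -/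
theorem FourPoint.exists_lintegral_product_le {δ : ℝ} (hX : FourPoint X δ) {ε η : ℝ} (hε : 0 < ε)
    (hεt : ε ≤ t) (hη : 0 < η) {N : ℕ}
    (h : ∀ z : X, ∫⁻ g, eexp (-(ε * (dist (g • o) z - dist o z))) ∂(stepLaw μ N) ≤ eexp (-η))
    (hμ : ∫⁻ g, eexp (t * dist o (g • o)) ∂μ < ∞) :
    ∃ B : ℝ≥0∞, B ≠ ∞ ∧ ∀ (n : ℕ) (z : X),
      ∫⁻ g, eexp (ε * gromovProduct o (g • o) z) ∂(stepLaw μ n) ≤ B := by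
  have ht : 0 ≤ t := hε.le.trans hεt
  -- Enough blocks for the contraction to beat the factor e^(εδ) coming from hyperbolicity, with a
  -- factor e⁻¹ ≤ 1/2 to spare.
  obtain ⟨j, hj⟩ := exists_nat_ge ((ε * δ + 1) / η)
  rw [div_le_iff₀ hη] at hj
  have hK := lintegral_cocycle_mul_le h j
  set K := j * N with hKdef
  have hK' : ∀ z : X, ∫⁻ g, eexp (-(ε * (dist (g • o) z - dist o z))) ∂(stepLaw μ K) ≤
      eexp (-(ε * δ + 1)) := fun z => (hK z).trans (eexp_le (by linarith))
  obtain ⟨T, hT, hTb⟩ := exists_lintegral_bound ht hμ K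
  have hhalf : eexp (ε * δ) * eexp (-(ε * δ + 1)) ≤ 1 / 2 := by
    rw [← eexp_add, show ε * δ + -(ε * δ + 1) = -1 by ring, eexp, Real.exp_neg, one_div,
      ENNReal.ofReal_inv_of_pos (Real.exp_pos 1)]
    refine ENNReal.inv_le_inv.2 ?_
    have := Real.add_one_le_exp (1 : ℝ)
    calc (2 : ℝ≥0∞) = ENNReal.ofReal 2 := by norm_num
      _ ≤ _ := ENNReal.ofReal_le_ofReal (by linarith)
  set M := eexp (ε * δ) * T with hM
  have hMtop : M ≠ ∞ := ENNReal.mul_ne_top (eexp_ne_top _) hT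
  -- Splitting off `K` steps bounds the moment by `M` plus half of an earlier one, so `2 * M` is
  -- stable; `T` covers times up to `K`.
  refine ⟨2 * M + T, ENNReal.add_ne_top.2 ⟨ENNReal.mul_ne_top (by norm_num) hMtop, hT⟩, ?_⟩
  intro n
  induction n using Nat.strong_induction_on with
  | _ n ih =>
  intro z
  rcases le_or_gt n K with hnK | hnK
  · refine le_trans ?_ (le_add_self)
    exact hTb n hnK ε hεt _ fun g => mul_le_mul_of_nonneg_left (gromovProduct_le_left _ _ _) hε.le
  have hK0 : 0 < K := by
    rcases Nat.eq_zero_or_pos K with h0 | h0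
    · have := hK' o
      rw [h0] at this
      simp only [stepLaw, lintegral_dirac, one_smul, dist_self, sub_zero, mul_zero, neg_zero] at this
      have h2 : eexp (-(ε * δ + 1)) < 1 := by
        have hδ := hX.nonneg
        rw [eexp, ENNReal.ofReal_lt_one]
        exact Real.exp_lt_one_iff.2 (by nlinarith)
      rw [eexp_zero] at this
      exact absurd this (not_le.2 h2)
    · exact h0
  obtain ⟨m, rfl⟩ := Nat.exists_eq_add_of_lt hnK
  rw [add_assoc, stepLaw_add, Measure.lintegral_mconv Measurable.of_discrete]
  have hB := ih (m + 1) (by omega)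
  set B := 2 * M + T with hBdef
  calc _ ≤ ∫⁻ x, ∫⁻ y, (eexp (ε * δ) * eexp (ε * dist o (x • o)) + eexp (ε * δ) *
        (eexp (-(ε * (dist (x • o) z - dist o z))) * eexp (ε * gromovProduct o (y • o) (x⁻¹ • z))))
        ∂(stepLaw μ (m + 1)) ∂(stepLaw μ K) := by
        refine lintegral_mono fun x => lintegral_mono fun y => ?_
        have h1 := hX.product_le_max o (x • o) ((x * y) • o) z
        have h2 : gromovProduct (x • o) ((x * y) • o) z = gromovProduct o (y • o) (x⁻¹ • z) := by
          rw [← gromovProduct_smul x o, smul_inv_smul, mul_smul]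
        rw [h2] at h1
        rw [← eexp_add, ← eexp_add, ← eexp_add]
        rcases le_max_iff.1 h1 with h3 | h3
        · refine le_trans (eexp_le ?_) le_self_add
          have := mul_le_mul_of_nonneg_left h3 hε.le
          linarith
        · refine le_trans (eexp_le ?_) le_add_self
          have := mul_le_mul_of_nonneg_left h3 hε.le
          linarith
    _ = eexp (ε * δ) * (∫⁻ x, eexp (ε * dist o (x • o)) ∂(stepLaw μ K)) + eexp (ε * δ) *
        ∫⁻ x, ∫⁻ y, eexp (-(ε * (dist (x • o) z - dist o z))) *
          eexp (ε * gromovProduct o (y • o) (x⁻¹ • z)) ∂(stepLaw μ (m + 1)) ∂(stepLaw μ K) := by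
        rw [← lintegral_const_mul _ Measurable.of_discrete,
          ← lintegral_const_mul _ Measurable.of_discrete,
          ← lintegral_add_left Measurable.of_discrete]
        refine lintegral_congr fun x => ?_
        rw [lintegral_add_left Measurable.of_discrete, lintegral_const, measure_univ, mul_one,
          lintegral_const_mul _ Measurable.of_discrete]
    _ ≤ M + eexp (ε * δ) * (eexp (-(ε * δ + 1)) * B) := by
        refine add_le_add (mul_le_mul_right (hTb K le_rfl ε hεt _ fun g => le_rfl) _)
          (mul_le_mul_right ?_ _)
        exact lintegral_cocycle_mul (fun g z => eexp (ε * gromovProduct o (g • o) z)) hK' hB z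
    _ ≤ M + 1 / 2 * B := by
        rw [← mul_assoc]; gcongr
    _ ≤ B := by
        rw [hBdef, mul_add, ← mul_assoc, one_div, ENNReal.inv_mul_cancel (by norm_num) (by norm_num),
          one_mul, ← add_assoc, ← two_mul]
        gcongr
        refine mul_le_of_le_one_left zero_le ?_
        exact ENNReal.inv_le_one.2 (by norm_num)

theorem measure_lt_le_of_lintegral_eexp {α : Type*} [MeasurableSpace α] [DiscreteMeasurableSpace α]
    {ν : Measure α} {ε : ℝ} (hε : 0 < ε) {f : α → ℝ} {B : ℝ≥0∞}
    (h : ∫⁻ x, eexp (ε * f x) ∂ν ≤ B) (b : ℝ) : ν {x | b < f x} ≤ B * eexp (-(ε * b)) := by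
  have h1 := mul_meas_ge_le_lintegral (μ := ν) (f := fun x => eexp (ε * f x))
    Measurable.of_discrete (eexp (ε * b))
  have h2 : ν {x | b < f x} ≤ ν {x | eexp (ε * b) ≤ eexp (ε * f x)} :=
    measure_mono fun x hx => eexp_le (mul_le_mul_of_nonneg_left (le_of_lt hx) hε.le)
  calc ν {x | b < f x} = eexp (-(ε * b)) * (eexp (ε * b) * ν {x | b < f x}) := by
        rw [← mul_assoc, ← eexp_add, neg_add_cancel, eexp_zero, one_mul]
    _ ≤ eexp (-(ε * b)) * B := by
        gcongr
        exact (mul_le_mul_right h2 _).trans (h1.trans h)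
    _ = _ := mul_comm _ _

/-- Linear progress with exponentially small error. -/
theorem exists_linear_progress {ε η : ℝ} (hε : 0 < ε) (hεt : ε ≤ t) (hη : 0 < η) {N : ℕ}
    (h : ∀ z : X, ∫⁻ g, eexp (-(ε * (dist (g • o) z - dist o z))) ∂(stepLaw μ N) ≤ eexp (-η))
    (hμ : ∫⁻ g, eexp (t * dist o (g • o)) ∂μ < ∞) :
    ∃ c : ℝ, 0 < c ∧ ∃ B : ℝ≥0∞, B ≠ ∞ ∧ ∀ n : ℕ,
      stepLaw μ n {g | dist o (g • o) < c * n} ≤ B * eexp (-(c * n)) := by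
  obtain ⟨T, hT, hTb⟩ := exists_lintegral_bound (hε.le.trans hεt) hμ N
  have hK := lintegral_cocycle_mul_le h
  set r := η / (N + 1) with hr
  have hr0 : 0 < r := by positivity
  have main : ∀ n : ℕ, ∫⁻ g, eexp (ε * (-dist o (g • o))) ∂(stepLaw μ n) ≤
      T * eexp η * eexp (-(r * n)) := fun n => by
    obtain ⟨j, i, hi, rfl, hj⟩ : ∃ j i : ℕ, i ≤ N ∧ n = j * N + i ∧ n ≤ (j + 1) * (N + 1) := by
      rcases Nat.eq_zero_or_pos N with h0 | h0
      · subst h0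
        exfalso
        have := h o
        simp only [stepLaw, lintegral_dirac, one_smul, dist_self, sub_zero, mul_zero, neg_zero,
          eexp_zero] at this
        have h2 : eexp (-η) < 1 := by
          rw [eexp, ENNReal.ofReal_lt_one]
          exact Real.exp_lt_one_iff.2 (by linarith)
        exact absurd this (not_le.2 h2)
      · have h1 := Nat.mod_lt n h0
        have h2 := Nat.div_add_mod' n N
        refine ⟨n / N, n % N, h1.le, h2.symm, ?_⟩
        nlinarith
    have h1 := lintegral_cocycle_add_le (hK j) (fun z => hTb i hi ε hεt _ fun g => by
      have := (abs_le.1 (abs_dist_smul_sub_le g o z)).1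
      have := mul_le_mul_of_nonneg_left this hε.le
      linarith) o
    simp only [dist_self, sub_zero] at h1
    simp only [mul_neg, dist_comm o]
    refine h1.trans ?_
    rw [mul_comm, mul_assoc, ← eexp_add]
    refine mul_le_mul_right (eexp_le ?_) _
    have h2 : ((j * N + i : ℕ) : ℝ) ≤ ((j + 1) * (N + 1) : ℕ) := by exact_mod_cast hj
    have h3 := mul_le_mul_of_nonneg_left h2 hr0.le
    have h4 : r * ((j + 1) * (N + 1) : ℕ) = (j + 1) * η := by
      rw [hr]; push_cast; field_simp
    linarith
  -- The solution of r - ε c = c, so that one constant serves as both speed and exponential rate.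
  refine ⟨r / (1 + ε), by positivity, T * eexp η, ENNReal.mul_ne_top hT (eexp_ne_top _),
    fun n => ?_⟩
  have h1 := measure_lt_le_of_lintegral_eexp hε (main n) (-(r / (1 + ε) * n))
  simp only [neg_lt_neg_iff] at h1
  refine h1.trans_eq ?_
  rw [mul_assoc, ← eexp_add]
  congr 2
  field_simp
  ring

end ExponentialMoments

/-! ### Laws and independence along the random walk -/

section WalkLaw

variable {Γ : Type*} [Group Γ] [Countable Γ] [MeasurableSpace Γ] [DiscreteMeasurableSpace Γ]
  (μ : Measure Γ) [IsProbabilityMeasure μ]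

instance walkMeasure.isProbabilityMeasure : IsProbabilityMeasure (walkMeasure μ) := by
  unfold walkMeasure; infer_instance

theorem measurable_walk (n : ℕ) : Measurable fun s : ℕ → Γ => walk s n := by
  induction n with
  | zero => exact measurable_const
  | succ n ih => exact ih.mul (measurable_pi_apply n)

theorem walk_congr {s s' : ℕ → Γ} {n : ℕ} (h : ∀ i < n, s i = s' i) : walk s n = walk s' n := by
  induction n with
  | zero => rfl
  | succ n ih => rw [walk, walk, ih fun i hi => h i (by omega), h n (by omega)]

theorem walk_add (s : ℕ → Γ) (k m : ℕ) :
    walk s (k + m) = walk s k * walk (fun i => s (k + i)) m := by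
  induction m with
  | zero => simp [walk]
  | succ m ih => rw [← add_assoc, walk, ih, walk, mul_assoc]

theorem indepFun_of_disjoint {S T : Finset ℕ} (hST : Disjoint S T) {F G : (ℕ → Γ) → Γ}
    (hF : Measurable F) (hG : Measurable G) (hFS : ∀ s s', (∀ i ∈ S, s i = s' i) → F s = F s')
    (hGT : ∀ s s', (∀ i ∈ T, s i = s' i) → G s = G s') :
    ProbabilityTheory.IndepFun F G (walkMeasure μ) := by
  have h := (ProbabilityTheory.iIndepFun_infinitePi (P := fun _ : ℕ => μ) (X := fun _ g => g)
    fun _ => measurable_id).indepFun_finset S T hST fun i => measurable_pi_apply i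
  -- Extending by 1 outside `U` writes each function as a function of finitely many coordinates.
  have hext : ∀ U : Finset ℕ, Measurable fun (v : U → Γ) (i : ℕ) =>
      if hi : i ∈ U then v ⟨i, hi⟩ else 1 := fun U => by
    refine measurable_pi_iff.2 fun i => ?_
    by_cases hi : i ∈ U
    · simpa [hi] using measurable_pi_apply _
    · simp [hi]
  have h2 := h.comp (hF.comp (hext S)) (hG.comp (hext T))
  rw [walkMeasure]
  convert h2 using 1
  · funext s; exact hFS _ _ fun i hi => by simp [hi]
  · funext s; exact hGT _ _ fun i hi => by simp [hi]

theorem map_walk (n : ℕ) : (walkMeasure μ).map (fun s => walk s n) = stepLaw μ n := by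
  induction n with
  | zero => simp [walk, stepLaw, Measure.map_const]
  | succ n ih =>
    have h := indepFun_of_disjoint μ (S := Finset.range n) (T := {n}) (by simp)
      (measurable_walk n) (measurable_pi_apply n)
      (fun s s' h => walk_congr fun i hi => h i (Finset.mem_range.2 hi)) (fun s s' h => by simpa using h)
    have h2 := h.map_mul_eq_map_mconv_map (measurable_walk n) (measurable_pi_apply n)
    rw [ih, walkMeasure, Measure.infinitePi_map_eval (fun _ : ℕ => μ) n] at h2
    exact h2

theorem map_walk_shift (k m : ℕ) :
    (walkMeasure μ).map (fun s => walk (fun i => s (k + i)) m) = stepLaw μ m := by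
  have h := Measure.map_infinitePi_infinitePi_of_inj (P := fun _ : ℕ => μ)
    (f := fun i : ℕ => k + i) (add_right_injective k)
  rw [← map_walk, walkMeasure]
  conv_rhs => rw [← h]
  rw [Measure.map_map (measurable_walk m) (by fun_prop)]
  rfl

/-- The position at time `k` and the subsequent displacement are independent. -/
theorem map_walk_prod (k m : ℕ) :
    (walkMeasure μ).map (fun s => (walk s k, walk (fun i => s (k + i)) m)) =
      (stepLaw μ k).prod (stepLaw μ m) := by
  have hm : Measurable fun s : ℕ → Γ => walk (fun i => s (k + i)) m :=
    (measurable_walk m).comp (by fun_prop)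
  have h := indepFun_of_disjoint μ (S := Finset.range k) (T := Finset.Ico k (k + m))
    (Finset.disjoint_left.2 fun i hi hi' => by simp at hi hi'; omega)
    (measurable_walk k) hm
    (fun s s' h => walk_congr fun i hi => h i (Finset.mem_range.2 hi))
    (fun s s' h => walk_congr fun i hi => h (k + i) (by simp; omega))
  rw [(ProbabilityTheory.indepFun_iff_map_prod_eq_prod_map_map
    (measurable_walk k).aemeasurable hm.aemeasurable).1 h, map_walk, map_walk_shift]

end WalkLaw

/-! ### Deviation estimate and almost sure convergence -/

section Deviation

variable {Γ X : Type*} [Group Γ] [Countable Γ] [MeasurableSpace Γ] [DiscreteMeasurableSpace Γ]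
  [MetricSpace X] [MulAction Γ X] [IsIsometricSMul Γ X] {μ : Measure Γ} [IsProbabilityMeasure μ]
  {o : X}

/-- Exponential deviation bound, for Gromov products. -/
theorem walkMeasure_product_le {ε : ℝ} (hε : 0 < ε) {B : ℝ≥0∞}
    (hB : ∀ (n : ℕ) (z : X), ∫⁻ g, eexp (ε * gromovProduct o (g • o) z) ∂(stepLaw μ n) ≤ B)
    {k n : ℕ} (hkn : k ≤ n) (b : ℝ) :
    walkMeasure μ {s | b < gromovProduct (walk s k • o) o (walk s n • o)} ≤
      B * eexp (-(ε * b)) := by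
  obtain ⟨m, rfl⟩ := Nat.exists_eq_add_of_le hkn
  have hA : MeasurableSet {p : Γ × Γ | b < gromovProduct o (p.2 • o) (p.1⁻¹ • o)} :=
    MeasurableSet.of_discrete
  have hm : Measurable fun s : ℕ → Γ => (walk s k, walk (fun i => s (k + i)) m) :=
    (measurable_walk k).prodMk ((measurable_walk m).comp (by fun_prop))
  have h1 : {s : ℕ → Γ | b < gromovProduct (walk s k • o) o (walk s (k + m) • o)} =
      (fun s : ℕ → Γ => (walk s k, walk (fun i => s (k + i)) m)) ⁻¹'
        {p : Γ × Γ | b < gromovProduct o (p.2 • o) (p.1⁻¹ • o)} := by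
    ext s
    simp only [Set.mem_ofPred_eq, Set.mem_preimage]
    rw [← gromovProduct_smul (walk s k) o, smul_inv_smul, smul_smul, ← walk_add,
      gromovProduct_comm]
  rw [h1, ← Measure.map_apply hm hA, map_walk_prod, Measure.prod_apply hA]
  calc _ ≤ ∫⁻ _, B * eexp (-(ε * b)) ∂(stepLaw μ k) :=
        lintegral_mono fun g => measure_lt_le_of_lintegral_eexp hε (hB m (g⁻¹ • o)) b
    _ = _ := by simp

/-- A sequence whose Gromov products grow linearly on dyadic scales converges to infinity. -/
theorem FourPoint.exists_product_ge_of_dyadic {δ : ℝ} (hX : FourPoint X δ) {x : ℕ → X} {c : ℝ}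
    (hc : 0 < c) {N : ℕ}
    (h : ∀ n ≥ N, ∀ m ≤ n, c * n ≤ gromovProduct o (x n) (x (n + m))) (R : ℝ) :
    ∃ N' : ℕ, ∀ n ≥ N', ∀ m ≥ N', R ≤ gromovProduct o (x n) (x m) := by
  have hδ := hX.nonneg
  obtain ⟨K, hK⟩ := exists_nat_ge ((|R| + δ) / c)
  rw [div_le_iff₀ hc] at hK
  set N' := max (max N K) 1
  have hN' : ∀ n : ℕ, N' ≤ n → |R| + δ ≤ c * n := fun n hn => by
    have h1 : (K : ℝ) ≤ n := by exact_mod_cast (show K ≤ n by omega)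
    nlinarith
  -- The chain passes through 2n. The bound there has already doubled, so the later errors are
  -- absorbed and only one `δ` is lost overall.
  have key : ∀ j n : ℕ, N' ≤ n → c * n - δ ≤ gromovProduct o (x n) (x (n + j)) := by
    intro j
    induction j using Nat.strong_induction_on with
    | _ j ih =>
    intro n hn
    rcases le_or_gt j n with hj | hj
    · have := h n (by omega) j hj
      linarith
    · have h1 := h n (by omega) n le_rfl
      have h2 := ih (j - n) (by omega) (n + n) (by omega)
      rw [show n + n + (j - n) = n + j by omega] at h2
      have h3 := hN' n hn
      have h4 := abs_nonneg R
      push_cast at h2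
      exact hX.le_product h1 (by linarith)
  refine ⟨N', fun n hn m hm => ?_⟩
  have aux : ∀ n m : ℕ, N' ≤ n → n ≤ m → R ≤ gromovProduct o (x n) (x m) := by
    intro n m hn hnm
    have h1 := key (m - n) n hn
    rw [Nat.add_sub_cancel' hnm] at h1
    have h2 := hN' n hn
    have h3 := le_abs_self R
    linarith
  rcases le_total n m with h | h
  · exact aux n m hn h
  · rw [gromovProduct_comm]; exact aux m n hm h

theorem tsum_mul_eexp_ne_top {r : ℝ} (hr : 0 < r) :
    ∑' n : ℕ, ((n + 1 : ℕ) : ℝ≥0∞) * eexp (-(r * n)) ≠ ∞ := by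
  have hx : ‖Real.exp (-r)‖ < 1 := by
    rw [Real.norm_of_nonneg (Real.exp_pos _).le]
    exact Real.exp_lt_one_iff.2 (by linarith)
  have hs : Summable fun n : ℕ => ((n : ℝ) + 1) * Real.exp (-r) ^ n := by
    simpa only [add_mul, pow_one, pow_zero, one_mul] using
      (summable_pow_mul_geometric_of_norm_lt_one 1 hx).add
        (summable_pow_mul_geometric_of_norm_lt_one 0 hx)
  have e : ∀ n : ℕ, ((n + 1 : ℕ) : ℝ≥0∞) * eexp (-(r * n)) =
      ENNReal.ofReal (((n : ℝ) + 1) * Real.exp (-r) ^ n) := fun n => by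
    rw [ENNReal.ofReal_mul (by positivity), ← Real.exp_nat_mul, eexp]
    congr 1
    · rw [← Nat.cast_succ, ENNReal.ofReal_natCast]
    · congr 2; ring
  simp only [e]
  rw [← ENNReal.ofReal_tsum_of_nonneg (fun n => by positivity) hs]
  exact ENNReal.ofReal_ne_top

/-- Almost surely, the Gromov products of the positions of the random walk tend to infinity. -/
theorem ae_exists_product_ge {δ : ℝ} (hX : FourPoint X δ) {ε c : ℝ} (hε : 0 < ε) (hc : 0 < c)
    {B B' : ℝ≥0∞} (hBtop : B ≠ ∞) (hBtop' : B' ≠ ∞)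
    (hB : ∀ (n : ℕ) (z : X), ∫⁻ g, eexp (ε * gromovProduct o (g • o) z) ∂(stepLaw μ n) ≤ B)
    (hB' : ∀ n : ℕ, stepLaw μ n {g | dist o (g • o) < c * n} ≤ B' * eexp (-(c * n))) :
    ∀ᵐ s ∂(walkMeasure μ), ∀ R : ℝ, ∃ N : ℕ, ∀ n ≥ N, ∀ m ≥ N,
      R ≤ gromovProduct o (walk s n • o) (walk s m • o) := by
  -- Restricting to m ≤ n leaves n + 1 exponentially unlikely deviations, a summable total. Outside
  -- `U n`, the product of ω_n o and ω_(n+m) o based at o is at least cn - cn/2.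
  set U : ℕ → Set (ℕ → Γ) := fun n => {s | dist o (walk s n • o) < c * n} ∪
    ⋃ m ∈ Finset.range (n + 1),
      {s | c / 2 * n < gromovProduct (walk s n • o) o (walk s (n + m) • o)} with hU
  set r := min c (ε * (c / 2)) with hr
  have hr0 : 0 < r := by positivity
  have h1 : ∀ n : ℕ, walkMeasure μ {s | dist o (walk s n • o) < c * n} ≤ B' * eexp (-(r * n)) := by
    intro n
    have h2 := hB' n
    rw [← map_walk, Measure.map_apply (measurable_walk n) MeasurableSet.of_discrete] at h2
    refine h2.trans (mul_le_mul_right (eexp_le ?_) _)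
    have := mul_le_mul_of_nonneg_right (min_le_left c (ε * (c / 2))) (Nat.cast_nonneg (α := ℝ) n)
    linarith
  have h2 : ∀ n m : ℕ, walkMeasure μ
      {s | c / 2 * n < gromovProduct (walk s n • o) o (walk s (n + m) • o)} ≤
        B * eexp (-(r * n)) := by
    intro n m
    refine (walkMeasure_product_le hε hB (Nat.le_add_right n m) _).trans
      (mul_le_mul_right (eexp_le ?_) _)
    have := mul_le_mul_of_nonneg_right (min_le_right c (ε * (c / 2))) (Nat.cast_nonneg (α := ℝ) n)
    linarith
  have h3 : ∀ n, walkMeasure μ (U n) ≤ (B' + B) * (((n + 1 : ℕ) : ℝ≥0∞) * eexp (-(r * n))) := by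
    intro n
    calc _ ≤ B' * eexp (-(r * n)) + ∑ m ∈ Finset.range (n + 1), B * eexp (-(r * n)) :=
          (measure_union_le _ _).trans (add_le_add (h1 n)
            ((measure_biUnion_finset_le _ _).trans (Finset.sum_le_sum fun m _ => h2 n m)))
      _ ≤ B' * (((n + 1 : ℕ) : ℝ≥0∞) * eexp (-(r * n))) +
          B * (((n + 1 : ℕ) : ℝ≥0∞) * eexp (-(r * n))) := by
          rw [Finset.sum_const, Finset.card_range, nsmul_eq_mul]
          refine add_le_add (mul_le_mul_right (le_mul_of_one_le_left zero_le ?_) _) (le_of_eq ?_)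
          · exact_mod_cast Nat.le_add_left 1 n
          · ring
      _ = _ := by ring
  have h4 : ∑' n, walkMeasure μ (U n) ≠ ∞ := by
    refine ne_top_of_le_ne_top ?_ (ENNReal.tsum_le_tsum h3)
    rw [ENNReal.tsum_mul_left]
    exact ENNReal.mul_ne_top (ENNReal.add_ne_top.2 ⟨hBtop', hBtop⟩) (tsum_mul_eexp_ne_top hr0)
  filter_upwards [ae_eventually_notMem h4] with s hs
  obtain ⟨N, hN⟩ := eventually_atTop.1 hs
  refine hX.exists_product_ge_of_dyadic (x := fun n => walk s n • o) (half_pos hc) (N := N) ?_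
  intro n hn m hm
  have h5 := hN n hn
  simp only [hU, Set.mem_union, Set.mem_iUnion, Set.mem_ofPred_eq, not_or, not_exists, not_lt] at h5
  have h6 := h5.2 m (Finset.mem_range.2 (by omega))
  have h7 := gromovProduct_add_gromovProduct o (walk s n • o) (walk s (n + m) • o)
  linarith [h5.1]

end Deviation

/-! ### The main theorem -/

theorem mainTheorem11 {X : Type*} [MetricSpace X] [ProperSpace X]
    (hgeod : IsGeodesicSpace X) (hhyp : IsGromovHyperbolic X)
    {Γ : Type*} [Group Γ] [Countable Γ] [MeasurableSpace Γ] [DiscreteMeasurableSpace Γ]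
    [MulAction Γ X] [IsIsometricSMul Γ X] (hne : IsNonElementary Γ X)
    (μ : Measure Γ) [IsProbabilityMeasure μ] (hgen : GeneratesAsSemigroup μ)
    (o : X) (hexp : HasExponentialMoment μ o) :
    (∀ᵐ s ∂(walkMeasure μ),
      (∃! ξ : GromovBoundary X, ConvergesToBoundary (fun m => walk s m • o) ξ) ∧
      ∃ γ : GeodesicRay X, γ.1 0 = o ∧
        ConvergesToBoundary (fun m => walk s m • o) γ.endpoint) ∧
    ∃ C : ℝ, 0 < C ∧ ∀ k n : ℕ, k ≤ n → ∀ a : ℝ, 1 < a →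
      walkMeasure μ {s | ∃ γ : ℝ → X, IsGeodesicBetween γ o (walk s n • o) ∧
          a < Metric.infDist (walk s k • o) (γ '' Set.Icc 0 (dist o (walk s n • o)))}
        ≤ ENNReal.ofReal (C * Real.exp (-a / C)) ∧
      walkMeasure μ {s | ∃ ξ : GromovBoundary X,
          ConvergesToBoundary (fun m => walk s m • o) ξ ∧
          ∃ γ : GeodesicRay X, γ.1 0 = o ∧ γ.endpoint = ξ ∧
            a < Metric.infDist (walk s k • o) (Set.range γ.1)}
        ≤ ENNReal.ofReal (C * Real.exp (-a / C)) := by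
  obtain ⟨δ, hX⟩ := hhyp.exists_fourPoint
  have hδ := hX.nonneg
  obtain ⟨t, ht, hμ⟩ := hexp
  obtain ⟨N, ε, η, hε, hεt, hη, hcontr⟩ := exists_contraction hgeod hX hne hgen ht hμ
  obtain ⟨B, hBtop, hB⟩ := hX.exists_lintegral_product_le hε hεt hη hcontr hμ
  obtain ⟨c, hc, B', hBtop', hB'⟩ := exists_linear_progress hε hεt hη hcontr hμ
  constructor
  · filter_upwards [ae_exists_product_ge hX hε hc hBtop hBtop' hB hB'] with s hs
    obtain ⟨γ, h0, hγ⟩ := hX.exists_ray_of_product hgeod o hs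
    exact ⟨⟨_, hγ, fun ξ hξ => hX.boundary_limit_unique hξ hγ⟩, γ, h0, hγ⟩
  -- The first term absorbs the additive error 3δ, which serves both segments and rays; the second
  -- ensures a / C ≤ ε a.
  set C := B.toReal * Real.exp (3 * ε * δ) + 1 / ε with hC
  have hC0 : 0 < C := by positivity
  have hdev : ∀ k n : ℕ, k ≤ n → ∀ a : ℝ, 1 < a →
      walkMeasure μ {s | a - 3 * δ < gromovProduct (walk s k • o) o (walk s n • o)} ≤
        ENNReal.ofReal (C * Real.exp (-a / C)) := by
    intro k n hkn a ha
    refine (walkMeasure_product_le hε hB hkn _).trans ?_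
    rw [← ENNReal.ofReal_toReal hBtop, eexp, ← ENNReal.ofReal_mul ENNReal.toReal_nonneg]
    refine ENNReal.ofReal_le_ofReal ?_
    rw [show -(ε * (a - 3 * δ)) = 3 * ε * δ + -(ε * a) by ring, Real.exp_add, ← mul_assoc]
    refine mul_le_mul ?_ (Real.exp_le_exp.2 ?_) (Real.exp_pos _).le hC0.le
    · rw [hC]; linarith [one_div_pos.2 hε]
    · rw [neg_div, neg_le_neg_iff, div_le_iff₀ hC0]
      have h1 : 1 ≤ ε * C := by
        rw [hC, mul_add, mul_one_div_cancel hε.ne']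
        have : 0 ≤ ε * (B.toReal * Real.exp (3 * ε * δ)) := by positivity
        linarith
      nlinarith
  refine ⟨C, hC0, fun k n hkn a ha => ⟨?_, ?_⟩⟩
  · refine (measure_mono ?_).trans (hdev k n hkn a ha)
    rintro s ⟨γ, hγ, hlt⟩
    have := hX.infDist_le hγ (walk s k • o)
    show a - 3 * δ < _
    linarith
  -- The ray event forces the deviation at all large times, so it lies in an increasing union of
  -- sets, each contained in the deviation event of a single time.
  · set V : ℕ → Set (ℕ → Γ) := fun M =>
      {s | ∀ n ≥ M, a - 3 * δ < gromovProduct (walk s k • o) o (walk s n • o)} with hV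
    have hmono : Monotone V := fun M M' hM s hs n hn => hs n (hM.trans hn)
    refine (measure_mono (t := ⋃ M, V M) ?_).trans ?_
    · rintro s ⟨_, hξ, γ, h0, rfl, hlt⟩
      obtain ⟨M, hM⟩ := hX.eventually_infDist_le hξ (walk s k • o)
      refine Set.mem_iUnion.2 ⟨M, fun n hn => ?_⟩
      have := hM n hn
      rw [h0] at this
      linarith
    · rw [hmono.measure_iUnion]
      refine iSup_le fun M => (measure_mono ?_).trans (hdev k (max M k) (le_max_right _ _) a ha)
      exact fun s hs => hs _ (le_max_left _ _)
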